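/- **Setting.** Let $\Omega$ be a discrete state space with an initial distribution $\mu$ such that $\mu(\sigma)>0$ for all $\sigma\in\Omega$. Let $\mathcal F$ be a family of flaws, i.e. subsets of $\Omega$. For each flaw $f$ and state $\sigma\in f$ a resampling oracle gives a random state $\mathfrak R_f(\sigma)$; put $A_f[\sigma,\sigma']=\Pr(\mathfrak R_f(\sigma)=\sigma')$ for $\sigma\in f$ and $A_f[\sigma,\sigma']=0$ for $\sigma\notin f$. Let $\sim$ be a symmetric and reflexive relation on $\mathcal F$ such that for distinct $f\not\sim g$ resampling $f$ never maps a state outside $g$ into $g$. Assume the oracle is T-commutative: $A_fA_g=A_gA_f$ whenever $f\not\sim g$. The charge of $f$ is $\gamma_f=\sup_{\tau\in\Omega}\sum_{\sigma\in f}\frac{\mu(\sigma)}{\mu(\tau)}A_f[\sigma,\tau]$. **Wdags.** A wdag is a finite directed acyclic graph $H$ with vertex labels $L(v)\in\mathcal F$ in which two distinct vertices $v,w$ are joined by an edge (in either direction) iff $L(v)\sim L(w)$; wdags are taken up to isomorphism. Its depth is the number of vertices on a longest directed path; $\mathrm{sink}(H)$ is the set of labels of its sink nodes; $|H|$ is its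 number of vertices; $w(H)=\prod_{v\in H}\gamma_{L(v)}$. Put $A_\emptyset=I$ and $A_H=A_{L(v)}A_{H-v}$ for any source node $v$ of $H$. A flaw $f$ is dominated by $H$ if $A_fA_H\vec 1\le A_H\vec 1$ entrywise. For a sequence of flaws $f_1,\dots,f_t$ with $t\ge 1$, build a wdag as follows: start with a single node labelled $f_t$; for $s=t-1,\dots,1$, if the current wdag has a source node with label $g\sim f_s$, or $f_s$ is not dominated by the current wdag, add a node labelled $f_s$ with an edge to every present node whose label is related to $f_s$. Let $\mathfrak H_{Q_1}$ be the set of wdags obtained in this way from all sequences $f_1,\dots,f_t$ of flaws that can be resampled in this order by the local search algorithm (which draws a state from $\mu$ and then repeatedly resamples some flaw holding in the current state). Let $\Phi_{Q_1}(f)=\sum_{H\in\mathfrak H_{Q_1},\,\mathrm{sink}(H)=\{f\}}w(H)$, and for $\epsilon>0$ let $W_\epsilon=\sum_{H\in\mathfrak H_{Q_1}}(1+\epsilon)^{|H|}w(H)$. **Algorithm.** Draw $\sigma$ from $\mu$. While some flaw holds on $\sigma$, run a round: let $V$ be the set of flaws holding on $\sigma$; while $V\ne\emptyset$, select a flaw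 $f\in V$ (by an arbitrary rule, which may be randomized and depend on the history), replace $\sigma$ by $\mathfrak R_f(\sigma)$, and remove from $V$ all flaws $g$ with $\sigma\notin g$ or $f\sim g$. Let $V_k$ be the set $V$ at the beginning of round $k$ ($V_k=\emptyset$ if there is no round $k$). **Claim.** For every such oracle and every selection rule: 1. $\sum_k\mathbf E[|V_k|]\le\sum_{f}\Phi_{Q_1}(f)$. 2. For every integer $t\ge1$, the probability that the algorithm runs for more than $2t$ rounds is at most $\frac1t\sum_{H\in\mathfrak H_{Q_1},\,\mathrm{depth}(H)\ge t}w(H)$. 3. For every $\epsilon_0>0$ there is a constant $C>0$, depending only on $\epsilon_0$, such that for all $\epsilon\in(0,\epsilon_0]$ with $W_\epsilon<\infty$ and all $\delta\in(0,1)$, with probability at least $1-\delta$ the algorithm terminates, runs for at most $C\,\frac{\log(1/\delta+\epsilon W_\epsilon)}{\epsilon}$ rounds, and satisfies $\sum_k|V_k|\le C\,W_\epsilon/\delta$. -/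

import Mathlib

open MeasureTheory ProbabilityTheory Finset
open scoped ENNReal Classical

universe u v

namespace LocalSearch

/-! ### Labelled witness DAGs -/

/-- A witness DAG on the vertex set `Fin n`, with labels in `F`, with respect to the relation `dep`:
a directed acyclic graph in which two distinct vertices are joined by an edge (in one of the two
directions) exactly if their labels are related. -/
structure Wdag {F : Type v} (dep : F → F → Prop) (n : ℕ) where
  label : Fin n → F
  edge : Fin n → Fin n → Prop
  acyclic : ∀ x, ¬ Relation.TransGen edge x x
  adj_iff : ∀ x y, x ≠ y → ((edge x y ∨ edge y x) ↔ dep (label x) (label y))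

namespace Wdag

variable {F : Type v} {dep : F → F → Prop}

/-- A source node: a vertex without incoming edges. -/
def IsSource {n : ℕ} (G : Wdag dep n) (x : Fin n) : Prop := ∀ y, ¬ G.edge y x

/-- A sink node: a vertex without outgoing edges. -/
def IsSink {n : ℕ} (G : Wdag dep n) (x : Fin n) : Prop := ∀ y, ¬ G.edge x y

theorem exists_source {n : ℕ} (G : Wdag dep (n + 1)) : ∃ x, G.IsSource x := by
  have : IsTrans (Fin (n + 1)) (Relation.TransGen G.edge) := ⟨fun _ _ _ => Relation.TransGen.trans⟩
  have : Std.Irrefl (Relation.TransGen G.edge) := ⟨G.acyclic⟩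
  have hwf := Finite.wellFounded_of_trans_of_irrefl (Relation.TransGen G.edge)
  obtain ⟨m, -, hm⟩ := hwf.has_min Set.univ ⟨0, trivial⟩
  exact ⟨m, fun y hy => hm y trivial (Relation.TransGen.single hy)⟩

/-- The wdag `G - x`. -/
def erase {n : ℕ} (G : Wdag dep (n + 1)) (x : Fin (n + 1)) : Wdag dep n where
  label := fun y => G.label (x.succAbove y)
  edge := fun y z => G.edge (x.succAbove y) (x.succAbove z)
  acyclic := fun y h =>
    G.acyclic (x.succAbove y) (Relation.TransGen.lift (r := fun y z => G.edge (x.succAbove y) (x.succAbove z)) x.succAbove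
      (fun _ _ h => h) y y h)
  adj_iff := fun y z h =>
    G.adj_iff (x.succAbove y) (x.succAbove z) (fun h' => h (Fin.succAbove_right_injective h'))

/-- The empty wdag. -/
def empty : Wdag dep 0 where
  label := fun x => x.elim0
  edge := fun x _ => x.elim0
  acyclic := fun x => x.elim0
  adj_iff := fun x => x.elim0

/-- The edges after adding a new vertex `0` with label `f` (the old vertices are shifted by one):
the new vertex has an edge to every old vertex whose label is related to `f`. -/
def addEdge {n : ℕ} (G : Wdag dep n) (f : F) : Fin (n + 1) → Fin (n + 1) → Prop :=
  fun x y => Fin.cases (motive := fun _ => Prop)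
    (Fin.cases (motive := fun _ => Prop) False (fun j => dep (G.label j) f) y)
    (fun i => Fin.cases (motive := fun _ => Prop) False (fun j => G.edge i j) y) x

theorem addEdge_trans {n : ℕ} (G : Wdag dep n) (f : F) {x y : Fin (n + 1)}
    (h : Relation.TransGen (G.addEdge f) x y) :
    ∃ j, y = Fin.succ j ∧ ∀ i, x = Fin.succ i → Relation.TransGen G.edge i j := by
  induction h with
  | @single z hz =>
    induction z using Fin.cases with
    | zero => induction x using Fin.cases <;> exact hz.elim
    | succ j =>
      refine ⟨j, rfl, ?_⟩
      rintro i rfl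
      exact Relation.TransGen.single hz
  | @tail y z _ hyz ih =>
    obtain ⟨j, rfl, hj⟩ := ih
    induction z using Fin.cases with
    | zero => exact hyz.elim
    | succ k => exact ⟨k, rfl, fun i hi => (hj i hi).tail hyz⟩

/-- Add to `G` a new source node labelled `f`, with an edge to each vertex whose label is related
to `f`. -/
def addNode {n : ℕ} (hsymm : ∀ f g, dep f g → dep g f) (f : F) (G : Wdag dep n) : Wdag dep (n + 1) where
  label := Fin.cons f G.label
  edge := G.addEdge f
  acyclic := by
    intro x h
    obtain ⟨j, rfl, hj⟩ := G.addEdge_trans f h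
    exact G.acyclic j (hj j rfl)
  adj_iff := by
    intro x y hxy
    induction x using Fin.cases with
    | zero =>
      induction y using Fin.cases with
      | zero => exact (hxy rfl).elim
      | succ j => simpa [addEdge] using ⟨hsymm _ _, hsymm _ _⟩
    | succ i =>
      induction y using Fin.cases with
      | zero => simp [addEdge]
      | succ j => simpa [addEdge] using G.adj_iff i j (fun h => hxy (by rw [h]))

/-- The depth of a wdag: the number of vertices on a longest directed path. -/
noncomputable def depth {n : ℕ} (G : Wdag dep n) : ℕ :=
  sSup {k | ∃ p : List (Fin n), p.IsChain G.edge ∧ p.length = k}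

/-- The set of labels of the sink nodes. -/
def sinkLabels {n : ℕ} (G : Wdag dep n) : Set F := {f | ∃ x, G.IsSink x ∧ G.label x = f}

/-- The product over all nodes of a weight that depends on the label. -/
noncomputable def weight {n : ℕ} (c : F → ℝ≥0∞) (G : Wdag dep n) : ℝ≥0∞ := ∏ x, c (G.label x)

end Wdag

section Classes

variable {F : Type v} (dep : F → F → Prop)

/-- Two wdags are isomorphic if a bijection of the vertices preserves labels and edges. -/
def WdagIso (G H : Σ n, Wdag dep n) : Prop :=
  ∃ e : Fin G.1 ≃ Fin H.1, (∀ x, H.2.label (e x) = G.2.label x) ∧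
    ∀ x y, H.2.edge (e x) (e y) ↔ G.2.edge x y

variable {dep} in
theorem WdagIso.symm {G H : Σ n, Wdag dep n} (h : WdagIso dep G H) : WdagIso dep H G := by
  obtain ⟨e, h1, h2⟩ := h
  exact ⟨e.symm, fun x => by simpa using (h1 (e.symm x)).symm,
    fun x y => by simpa using (h2 (e.symm x) (e.symm y)).symm⟩

/-- Isomorphism as an equivalence relation. -/
def wdagSetoid : Setoid (Σ n, Wdag dep n) where
  r := WdagIso dep
  iseqv :=
    { refl := fun G => ⟨Equiv.refl _, fun _ => rfl, fun _ _ => Iff.rfl⟩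
      symm := WdagIso.symm
      trans := by
        rintro G H K ⟨e, h1, h2⟩ ⟨e', h3, h4⟩
        exact ⟨e.trans e', fun x => by simp [h1, h3], fun x y => by simp [h2, h4]⟩ }

/-- Wdags up to isomorphism; sums over wdags count each isomorphism class once. -/
def WdagClass : Type v := Quotient (wdagSetoid dep)

variable {dep}

/-- The isomorphism class of a wdag. -/
def Wdag.toClass (G : Σ n, Wdag dep n) : WdagClass dep := Quotient.mk (wdagSetoid dep) G

theorem WdagIso.depth_set_subset {G H : Σ n, Wdag dep n} (h : WdagIso dep G H) :
    {k | ∃ p : List (Fin G.1), p.IsChain G.2.edge ∧ p.length = k} ⊆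
      {k | ∃ p : List (Fin H.1), p.IsChain H.2.edge ∧ p.length = k} := by
  obtain ⟨e, -, h2⟩ := h
  rintro k ⟨p, hp, hk⟩
  refine ⟨p.map e, ?_, by simpa using hk⟩
  rw [List.isChain_map]
  exact hp.imp (fun x y hxy => (h2 x y).2 hxy)

theorem WdagIso.sinkLabels_subset {G H : Σ n, Wdag dep n} (h : WdagIso dep G H) :
    G.2.sinkLabels ⊆ H.2.sinkLabels := by
  obtain ⟨e, h1, h2⟩ := h
  rintro f ⟨x, hx, rfl⟩
  refine ⟨e x, fun y hy => hx (e.symm y) ((h2 x (e.symm y)).1 (by simpa using hy)), h1 x⟩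

/-- The depth of an isomorphism class of wdags. -/
noncomputable def WdagClass.depth (H : WdagClass dep) : ℕ :=
  Quotient.lift (s := wdagSetoid dep) (fun G => G.2.depth)
    (fun _ _ h => congrArg sSup
      (Set.Subset.antisymm (WdagIso.depth_set_subset h) (WdagIso.depth_set_subset h.symm))) H

/-- The set `sink(H)` of labels of sink nodes. -/
def WdagClass.sink (H : WdagClass dep) : Set F :=
  Quotient.lift (s := wdagSetoid dep) (fun G => G.2.sinkLabels)
    (fun _ _ h =>
      Set.Subset.antisymm (WdagIso.sinkLabels_subset h) (WdagIso.sinkLabels_subset h.symm)) H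

/-- The product over the nodes `x` of `H` of the weights `c (L(x))`. -/
noncomputable def WdagClass.weight (c : F → ℝ≥0∞) (H : WdagClass dep) : ℝ≥0∞ :=
  Quotient.lift (s := wdagSetoid dep) (fun G => G.2.weight c)
    (fun _ _ h => by
      obtain ⟨e, h1, -⟩ := h
      exact Fintype.prod_equiv e _ _ (fun x => by rw [h1])) H

end Classes

/-! ### Resampling oracles -/

/-- A discrete state space `Ω` with an initial distribution `init` (called `μ`), a family of flaws
indexed by `F` (each flaw `f` is an event `flaw f ⊆ Ω`), a randomized resampling procedure
`oracle f σ` (only its values at states `σ ∈ flaw f` matter), and a dependency relation `dep`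
(written `f ∼ g`): it is symmetric and reflexive, and for distinct unrelated flaws `f`, `g`,
resampling `f` never leads from a state outside `g` to a state in `g`. -/
structure ResamplingOracle (Ω : Type u) (F : Type v) where
  init : PMF Ω
  flaw : F → Set Ω
  oracle : F → Ω → PMF Ω
  dep : F → F → Prop
  dep_symm : ∀ f g, dep f g → dep g f
  dep_refl : ∀ f, dep f f
  not_cause : ∀ f g, f ≠ g → ¬ dep f g → ∀ σ τ, σ ∈ flaw f → σ ∉ flaw g →
    oracle f σ τ ≠ 0 → τ ∉ flaw g

/-- Product of nonnegative matrices indexed by a possibly infinite set of states. -/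
noncomputable def matMul {Ω : Type u} (M N : Ω → Ω → ℝ≥0∞) : Ω → Ω → ℝ≥0∞ :=
  fun σ τ => ∑' ρ, M σ ρ * N ρ τ

/-- The identity matrix. -/
noncomputable def matOne {Ω : Type u} : Ω → Ω → ℝ≥0∞ := fun σ τ => if σ = τ then 1 else 0

namespace ResamplingOracle

variable {Ω : Type u} {F : Type v} (R : ResamplingOracle Ω F)

/-- The transition matrix `A_f`. -/
noncomputable def A (f : F) : Ω → Ω → ℝ≥0∞ :=
  fun σ τ => if σ ∈ R.flaw f then R.oracle f σ τ else 0

/-- T-commutativity: the transition matrices of unrelated flaws commute. -/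
def TCommutative : Prop :=
  ∀ f g, ¬ R.dep f g → matMul (R.A f) (R.A g) = matMul (R.A g) (R.A f)

/-- The charge `γ_f = max_τ ∑_{σ ∈ f} (μ(σ) / μ(τ)) A_f[σ, τ]`. -/
noncomputable def charge (f : F) : ℝ≥0∞ := ⨆ τ, ∑' σ, R.init σ / R.init τ * R.A f σ τ

/-- The matrix `A_H`: the identity for the empty wdag, and otherwise `A_{L(x)} A_{H - x}` for an
arbitrarily chosen source node `x`. -/
noncomputable def wdagMat : (n : ℕ) → Wdag R.dep n → Ω → Ω → ℝ≥0∞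
  | 0, _ => matOne
  | n + 1, G =>
    matMul (R.A (G.label G.exists_source.choose)) (wdagMat n (G.erase G.exists_source.choose))

/-- `f` is dominated by `H` if `A_f A_H 1 ≤ A_H 1` entrywise, with `1` the all-ones vector. -/
def Dominated (f : F) (G : Σ n, Wdag R.dep n) : Prop :=
  ∀ σ, ∑' τ, matMul (R.A f) (R.wdagMat G.1 G.2) σ τ ≤ ∑' τ, R.wdagMat G.1 G.2 σ τ

/-- The rule `Q₁`: `f ∈ Q₁(H)` iff `H` has a source node whose label is related to `f`. -/
def ruleOne (f : F) (G : Σ n, Wdag R.dep n) : Prop :=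
  ∃ x, G.2.IsSource x ∧ R.dep (G.2.label x) f

/-- `GenWitness(Q, T, t)` for the initial segment `[f₁, …, f_t]` of `T`. One starts with a single
node labelled `f_t` and goes backward in time; a node labelled `f_s` is added iff
`f_s ∈ Q(G)` or `f_s` is not dominated by the current wdag `G`. -/
noncomputable def genWitness (Q : F → (Σ n, Wdag R.dep n) → Prop) : List F → Σ n, Wdag R.dep n
  | [] => ⟨0, Wdag.empty⟩
  | [f] => ⟨1, Wdag.addNode R.dep_symm f Wdag.empty⟩
  | f :: g :: l =>
    if Q f (genWitness Q (g :: l)) ∨ ¬ R.Dominated f (genWitness Q (g :: l)) then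
      ⟨(genWitness Q (g :: l)).1 + 1, Wdag.addNode R.dep_symm f (genWitness Q (g :: l)).2⟩
    else genWitness Q (g :: l)

/-- `Possible σ [f₁, …, f_t]`: started in the state `σ`, the local search algorithm can, for some
way to select the flaws, resample `f₁, …, f_t` in this order. -/
inductive Possible : Ω → List F → Prop
  | nil (σ : Ω) : Possible σ []
  | cons {σ τ : Ω} {f : F} {l : List F} (hσ : σ ∈ R.flaw f) (hτ : R.oracle f σ τ ≠ 0)
      (h : Possible τ l) : Possible σ (f :: l)

/-- The set `ℌ_Q` of non-empty wdags, up to isomorphism, that can be produced as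
`GenWitness(Q, T, t)` from a trajectory `T` of the local search algorithm. -/
def generated (Q : F → (Σ n, Wdag R.dep n) → Prop) : Set (WdagClass R.dep) :=
  {H | ∃ σ l, R.init σ ≠ 0 ∧ l ≠ [] ∧ R.Possible σ l ∧ H = Wdag.toClass (R.genWitness Q l)}

/-- `Φ_Q(f)`: the sum of `w(H)` over all `H ∈ ℌ_Q` with `sink(H) = {f}`, where `w(H)` is the product
of the charges of the labels. -/
noncomputable def Phi (Q : F → (Σ n, Wdag R.dep n) → Prop) (f : F) : ℝ≥0∞ :=
  ∑' H : {H : WdagClass R.dep // H ∈ R.generated Q ∧ H.sink = {f}}, H.1.weight R.charge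

/-- `W_ε`: the sum over `H ∈ ℌ_{Q₁}` of `w_ε(H) = ∏_{x ∈ H} (1 + ε) γ_{L(x)}`. -/
noncomputable def inflatedSum (ε : ℝ) : ℝ≥0∞ :=
  ∑' H : {H : WdagClass R.dep // H ∈ R.generated R.ruleOne},
    H.1.weight (fun f => ENNReal.ofReal (1 + ε) * R.charge f)

end ResamplingOracle

/-! ### The generic parallel framework -/

/-- A configuration of the generic parallel framework: the states visited and flaws resampled so far
(latest first), the current state, the current set `V`, and the number of the current round. -/
structure Config (Ω : Type u) (F : Type v) where
  past : List (Ω × F)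
  state : Ω
  active : Set F
  round : ℕ

instance {Ω : Type u} {F : Type v} : MeasurableSpace (Config Ω F) := ⊤

/-- A rule for selecting a flaw `f ∈ V`. It is arbitrary: it may be randomized and may depend on
the whole history. -/
structure Selector (Ω : Type u) (F : Type v) where
  pick : (c : Config Ω F) → c.active.Nonempty → PMF F
  pick_mem : ∀ c h, ∀ f ∈ (pick c h).support, f ∈ c.active

/-- The canonical law on `ℕ → C` of the time-homogeneous Markov chain with the given initial law and
transition probabilities (Ionescu-Tulcea). -/
noncomputable def chainLaw {C : Type*} [MeasurableSpace C] [DiscreteMeasurableSpace C]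
    (init : PMF C) (step : C → PMF C) : Measure (ℕ → C) :=
  let κ : Kernel C C := ⟨fun c => (step c).toMeasure, Measurable.of_discrete⟩
  haveI : IsMarkovKernel κ := ⟨fun c => inferInstanceAs (IsProbabilityMeasure (step c).toMeasure)⟩
  (init.toMeasure.map (fun c (_ : Iic 0) => c)).bind
    (Kernel.traj (X := fun _ => C)
      (fun n => κ.comap (fun x : (i : Iic n) → C => x ⟨n, by simp⟩) (measurable_pi_apply _)) 0)

namespace ResamplingOracle

variable {Ω : Type u} {F : Type v} (R : ResamplingOracle Ω F)

/-- The beginning: the first round starts, with `V` the set of all flaws of the initial state. -/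
def start (σ : Ω) : Config Ω F where
  past := []
  state := σ
  active := {f | σ ∈ R.flaw f}
  round := 1

/-- The set `V` after `f` was resampled with result `τ`: all flaws `g` with `τ ∉ g` or `f ∼ g` are
removed. -/
def remaining (c : Config Ω F) (f : F) (τ : Ω) : Set F :=
  {g ∈ c.active | τ ∈ R.flaw g ∧ ¬ R.dep f g}

/-- The configuration after resampling `f` with result `τ`. If `V` became empty, then the round is
over and `V` is set to the set of all flaws of `τ` for the next round. -/
noncomputable def next (c : Config Ω F) (f : F) (τ : Ω) : Config Ω F where
  past := (c.state, f) :: c.past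
  state := τ
  active := if (R.remaining c f τ).Nonempty then R.remaining c f τ else {g | τ ∈ R.flaw g}
  round := if (R.remaining c f τ).Nonempty then c.round else c.round + 1

/-- One resampling. If no flaw holds, then the algorithm has stopped. -/
noncomputable def step (S : Selector Ω F) (c : Config Ω F) : PMF (Config Ω F) :=
  if h : c.active.Nonempty then
    (S.pick c h).bind (fun f => (R.oracle f c.state).map (fun τ => R.next c f τ))
  else PMF.pure c

/-- The law of the execution of the generic parallel framework with the selection rule `S`, as a
measure on sequences of configurations (constant after termination). -/
noncomputable def runLaw (S : Selector Ω F) : Measure (ℕ → Config Ω F) :=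
  chainLaw (R.init.map R.start) (R.step S)

end ResamplingOracle

section Execution

variable {Ω : Type u} {F : Type v}

/-- The set `V_k` of flaws at the beginning of round `k` (empty if there is no such round). -/
def roundFlaws (k : ℕ) (ω : ℕ → Config Ω F) : Set F :=
  {f | ∃ n, (ω n).round = k ∧ (∀ m < n, (ω m).round < k) ∧ f ∈ (ω n).active}

/-- The number of rounds that are executed. -/
noncomputable def numRounds (ω : ℕ → Config Ω F) : ℕ∞ :=
  {k | ∃ n, (ω n).round = k ∧ (ω n).active.Nonempty}.encard

/-- The execution terminates: it reaches a state without flaws. -/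
def ResamplingOracle.Terminates (R : ResamplingOracle Ω F) (ω : ℕ → Config Ω F) : Prop :=
  ∃ n, ∀ f, (ω n).state ∉ R.flaw f

end Execution

end LocalSearch

open LocalSearch

namespace LocalSearch

/-! ### Laws of Markov chains with discrete transition probabilities -/

section Chain

variable {C : Type*} [MeasurableSpace C] [DiscreteMeasurableSpace C]

/-! The core is that a fixed wdag `H` appears with probability at most `w(H)`. Here "appears" means
that at some time the past resamplings, followed by one flaw `f` of the current state, generate `H`;
it is not required that `f` is ever resampled. Given a past `p`, consider the sequences `l` for
which `p ++ l` generates `H`. By the cancellation property of the rule `Q₁`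
(`witness_append_cancel`) they all generate the same wdag `G`, so the potential `(A_G 1)(σ)` at the
current state `σ` is well defined, with value `0` if there is no `l`. It is a supermartingale: `A_f
(A_G 1)` is at most the row sum of the wdag obtained by prepending `f`, with equality if a node is
added, and by domination otherwise. It is at least `1` when `H` can be completed, and its initial
mean is at most `μᵀ A_H 1 ≤ w(H)`, each matrix costing one charge. T-commutativity makes `A_H 1`
independent of the chosen sources. The maximal inequality `chainLaw_hit_le` concludes.

The rest is counting. The flaws resampled in one round are mutually unrelated, and each flaw of the
next `V` is related to one of them, because unrelated resamplings cannot create it. Hence the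
history at the beginning of round `k` followed by `f ∈ V_k` generates a wdag of depth exactly `k`
with sink `{f}` (`exists_appears`). Different pairs `(k, f)` give different wdags, so `∑ |V_k|` is
at most the number of wdags that appear, and the number of rounds from `t` on is at most the number
of those of depth at least `t`. Expectations and Markov's inequality give parts 1 and 2. For part 3,
`(1+ε)^t w(H) ≤ w_ε(H)` whenever `H` has depth at least `t`, and `t` is optimized in
`exists_round_bound`. -/

theorem lintegral_pmf (p : PMF C) (g : C → ℝ≥0∞) :
    ∫⁻ c, g c ∂p.toMeasure = ∑' c, p c * g c := by
  rw [← PMF.restrict_toMeasure_support p, lintegral_countable g p.support_countable]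
  have h : ∀ c : p.support, g c * p.toMeasure {(c : C)} = (fun c => p c * g c) c := fun c => by
    rw [PMF.toMeasure_apply_singleton _ _ (MeasurableSet.of_discrete), mul_comm]
  rw [tsum_congr h]
  refine tsum_subtype_eq_of_support_subset (f := fun c => p c * g c) fun c hc => ?_
  rw [PMF.mem_support_iff]
  exact left_ne_zero_of_mul hc

/-- The transition probabilities as kernels on finite histories. -/
noncomputable def historyKernel (step : C → PMF C) (n : ℕ) :
    Kernel ((_ : Iic n) → C) C :=
  Kernel.comap ⟨fun c => (step c).toMeasure, Measurable.of_discrete⟩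
    (fun x : (i : Iic n) → C => x ⟨n, by simp⟩) (measurable_pi_apply _)

theorem historyKernel_apply (step : C → PMF C) (n : ℕ) (x : (_ : Iic n) → C) :
    historyKernel step n x = (step (x ⟨n, by simp⟩)).toMeasure := rfl

instance (step : C → PMF C) (n : ℕ) : IsMarkovKernel (historyKernel step n) :=
  ⟨fun x => by rw [historyKernel_apply]; infer_instance⟩

theorem chainLaw_eq_trajMeasure (init : PMF C) (step : C → PMF C) :
    chainLaw init step =
      Kernel.trajMeasure (X := fun _ => C) init.toMeasure (historyKernel step) := rfl

instance (init : PMF C) (step : C → PMF C) : IsProbabilityMeasure (chainLaw init step) := by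
  rw [chainLaw_eq_trajMeasure]; infer_instance

/-- The joint law of the history up to time `n` and of the next state is the law of the history
composed with the transition kernel. The factor `h` allows conditioning on events of the past. -/
theorem chainLaw_markov (init : PMF C) (step : C → PMF C) (n : ℕ)
    {h : ((_ : Iic n) → C) → ℝ≥0∞} (hh : Measurable h) (g : C → ℝ≥0∞) :
    ∫⁻ ω, h (Preorder.frestrictLe n ω) * g (ω (n + 1)) ∂(chainLaw init step) =
      ∫⁻ ω, h (Preorder.frestrictLe n ω) * ∑' c, step (ω n) c * g c ∂(chainLaw init step) := by
  have hg : Measurable g := Measurable.of_discrete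
  have hg2 : Measurable fun p : ((_ : Iic n) → C) × C => h p.1 * g p.2 := by fun_prop
  have key := Kernel.map_frestrictLe_trajMeasure_compProd_eq_map_trajMeasure (X := fun _ => C)
    (μ₀ := init.toMeasure) (κ := historyKernel step) (a := n)
  have e1 := lintegral_map (μ := chainLaw init step) hg2
    (g := fun x => (Preorder.frestrictLe n x, x (n + 1))) (by fun_prop)
  rw [← e1]
  rw [chainLaw_eq_trajMeasure, ← key, Measure.lintegral_compProd hg2,
    lintegral_map _ (by fun_prop)]
  · refine lintegral_congr fun ω => ?_
    rw [historyKernel_apply]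
    dsimp only
    rw [lintegral_const_mul _ hg, lintegral_pmf]
    rfl
  · exact Measurable.lintegral_kernel_prod_right' hg2

theorem chainLaw_zero (init : PMF C) (step : C → PMF C) (g : C → ℝ≥0∞) :
    ∫⁻ ω, g (ω 0) ∂(chainLaw init step) = ∑' c, init c * g c := by
  have hg : Measurable g := Measurable.of_discrete
  rw [← lintegral_pmf]
  have : (chainLaw init step).map (fun ω => ω 0) = init.toMeasure := by
    rw [chainLaw_eq_trajMeasure, Kernel.trajMeasure]
    have e : (fun ω : ℕ → C => ω 0) =
      (MeasurableEquiv.piUnique (fun _ : Iic 0 => C)) ∘ Preorder.frestrictLe 0 := rfl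
    rw [e, ← Measure.map_map (by fun_prop) (by fun_prop), Measure.map_comp _ _ (by fun_prop),
      Kernel.traj_map_frestrictLe, Kernel.partialTraj_self, Measure.id_comp,
      Measure.map_map (by fun_prop) (by fun_prop), MeasurableEquiv.self_comp_symm, Measure.map_id]
  rw [← this, lintegral_map hg (by fun_prop)]

/-- The maximal inequality for nonnegative supermartingales that are functions of the state. -/
theorem chainLaw_hit_le (init : PMF C) (step : C → PMF C) (Ψ : C → ℝ≥0∞)
    (hstep : ∀ c, ∑' c', step c c' * Ψ c' ≤ Ψ c) (B : Set C) (hB : ∀ c ∈ B, 1 ≤ Ψ c) :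
    chainLaw init step {ω | ∃ n, ω n ∈ B} ≤ ∑' c, init c * Ψ c := by
  set m := chainLaw init step
  have mB : ∀ i, MeasurableSet {ω : ℕ → C | ω i ∈ B} := fun i =>
    (measurable_pi_apply i) (MeasurableSet.of_discrete (s := B))
  have mΨ : Measurable Ψ := Measurable.of_discrete
  have mH : ∀ n, MeasurableSet {ω : ℕ → C | ∃ i < n, ω i ∈ B} := fun n => by
    have : {ω : ℕ → C | ∃ i < n, ω i ∈ B} = ⋃ i, ⋃ (_ : i < n), {ω | ω i ∈ B} := by
      ext; simp
    rw [this]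
    exact MeasurableSet.iUnion fun i => MeasurableSet.iUnion fun _ => mB i
  -- Mean of the process stopped when it meets `B`, with the value there lowered to `1`. It does not
  -- increase with `n`.
  have claim : ∀ n, m {ω | ∃ i < n, ω i ∈ B} +
      ∫⁻ ω, ({ω | ∃ i < n, ω i ∈ B}ᶜ.indicator 1 ω) * Ψ (ω n) ∂m ≤ ∑' c, init c * Ψ c := by
    intro n
    induction n with
    | zero => simp [m, chainLaw_zero]
    | succ n ih =>
      refine le_trans ?_ ih
      set D : Set (ℕ → C) := {ω | ∃ i < n, ω i ∈ B}
      set D' : Set (ℕ → C) := {ω | ∃ i < n + 1, ω i ∈ B}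
      have hD' : D' = D ∪ (Dᶜ ∩ {ω | ω n ∈ B}) := by
        ext ω
        simp only [D, D', Set.mem_ofPred_eq, Set.mem_union, Set.mem_inter_iff, Set.mem_compl_iff]
        constructor
        · rintro ⟨i, hi, h⟩
          by_cases h' : ∃ i < n, ω i ∈ B
          · exact Or.inl h'
          · right
            refine ⟨h', ?_⟩
            rcases Nat.lt_succ_iff_lt_or_eq.1 hi with h2 | rfl
            · exact (h' ⟨i, h2, h⟩).elim
            · exact h
        · rintro (⟨i, hi, h⟩ | ⟨-, h⟩)
          · exact ⟨i, by omega, h⟩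
          · exact ⟨n, by omega, h⟩
      let E : Set ((_ : Iic n) → C) := {x | ∃ i : Iic n, x i ∈ B}
      have mE : MeasurableSet E := by
        have : E = ⋃ i, {x | x i ∈ B} := by ext; simp [E]
        rw [this]
        exact MeasurableSet.iUnion fun i =>
          (measurable_pi_apply i) (MeasurableSet.of_discrete (s := B))
      -- Avoiding `B` up to time `n` is an event of the history, so the Markov property applies to
      -- it.
      have hE : ∀ ω, D'ᶜ.indicator (1 : (ℕ → C) → ℝ≥0∞) ω =
          Eᶜ.indicator 1 (Preorder.frestrictLe n ω) := by
        intro ω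
        have : ω ∈ D' ↔ Preorder.frestrictLe n ω ∈ E := by
          simp [D', E]
        by_cases h : ω ∈ D'
        · have h2 := this.1 h
          rw [Set.indicator_of_notMem (by simpa using h), Set.indicator_of_notMem (by simpa using h2)]
        · have h2 := fun h3 => h (this.2 h3)
          rw [Set.indicator_of_mem (by simpa using h), Set.indicator_of_mem (by simpa using h2)]
          rfl
      have e1 : ∫⁻ ω, D'ᶜ.indicator 1 ω * Ψ (ω (n + 1)) ∂m ≤
          ∫⁻ ω, D'ᶜ.indicator 1 ω * Ψ (ω n) ∂m := by
        simp_rw [hE]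
        rw [chainLaw_markov init step n (measurable_one.indicator mE.compl)]
        exact lintegral_mono fun ω => mul_le_mul_right (hstep _) _
      have e2 : m D' = m D + ∫⁻ ω, (Dᶜ ∩ {ω | ω n ∈ B}).indicator 1 ω ∂m := by
        rw [hD', measure_union (Set.disjoint_left.2 fun ω h h' => h'.1 h) ((mH n).compl.inter (mB n)),
          lintegral_indicator_one ((mH n).compl.inter (mB n))]
      calc m D' + ∫⁻ ω, D'ᶜ.indicator 1 ω * Ψ (ω (n + 1)) ∂m
          ≤ m D + (∫⁻ ω, (Dᶜ ∩ {ω | ω n ∈ B}).indicator 1 ω ∂m +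
              ∫⁻ ω, D'ᶜ.indicator 1 ω * Ψ (ω n) ∂m) := by
            rw [e2, add_assoc]; gcongr
        _ ≤ m D + ∫⁻ ω, Dᶜ.indicator 1 ω * Ψ (ω n) ∂m := by
            gcongr
            rw [← lintegral_add_left (measurable_one.indicator ((mH n).compl.inter (mB n)))]
            refine lintegral_mono fun ω => ?_
            by_cases h1 : ω ∈ D
            · have : ω ∈ D' := hD' ▸ Or.inl h1
              rw [Set.indicator_of_notMem (fun h => h.1 h1),
                Set.indicator_of_notMem (Set.notMem_compl_iff.2 this)]
              simp
            · by_cases h2 : ω n ∈ B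
              · have : ω ∈ D' := hD' ▸ Or.inr ⟨h1, h2⟩
                rw [Set.indicator_of_mem (show ω ∈ Dᶜ ∩ {ω | ω n ∈ B} from ⟨h1, h2⟩),
                  Set.indicator_of_notMem (Set.notMem_compl_iff.2 this),
                  Set.indicator_of_mem (show ω ∈ Dᶜ from h1)]
                simpa using hB _ h2
              · have : ω ∉ D' := by
                  rw [hD']; rintro (h | h)
                  exacts [h1 h, h2 h.2]
                rw [Set.indicator_of_notMem (fun h => h2 h.2),
                  Set.indicator_of_mem (show ω ∈ D'ᶜ from this),
                  Set.indicator_of_mem (show ω ∈ Dᶜ from h1), zero_add]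
  have hU : {ω : ℕ → C | ∃ n, ω n ∈ B} = ⋃ n : ℕ, {ω | ∃ i < n, ω i ∈ B} := by
    ext ω
    simp only [Set.mem_ofPred_eq, Set.mem_iUnion]
    exact ⟨fun ⟨n, h⟩ => ⟨n + 1, n, by omega, h⟩, fun ⟨_, i, _, h⟩ => ⟨i, h⟩⟩
  have hmono : Monotone fun n : ℕ => {ω : ℕ → C | ∃ i < n, ω i ∈ B} :=
    fun a b hab ω ⟨i, hi, h⟩ => ⟨i, by omega, h⟩
  rw [hU, hmono.measure_iUnion]
  exact iSup_le fun n => le_self_add.trans (claim n)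

theorem chainLaw_hit_measurable (B : Set C) : MeasurableSet {ω : ℕ → C | ∃ n, ω n ∈ B} := by
  rw [Set.ofPred_exists]
  exact MeasurableSet.iUnion fun i =>
    (measurable_pi_apply i) (MeasurableSet.of_discrete (s := B))

theorem chainLaw_ae_init (init : PMF C) (step : C → PMF C) :
    ∀ᵐ ω ∂(chainLaw init step), init (ω 0) ≠ 0 := by
  have h := chainLaw_zero init step ({c | init c = 0}.indicator 1)
  have : ∑' c, init c * {c | init c = 0}.indicator (1 : C → ℝ≥0∞) c = 0 := by
    rw [ENNReal.tsum_eq_zero]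
    intro c
    by_cases hc : init c = 0 <;> simp [hc]
  rw [this, lintegral_eq_zero_iff (by
    exact (Measurable.of_discrete (f := {c | init c = 0}.indicator (1 : C → ℝ≥0∞))).comp
      (measurable_pi_apply 0))] at h
  filter_upwards [h] with ω hω h0
  simp [h0] at hω

/-- Needed since `C` may be uncountable: statements about two successive states can then be checked
for each value of the first one and combined by a countable intersection. -/
theorem chainLaw_ae_countable (init : PMF C) (step : C → PMF C) (n : ℕ) :
    ∃ K : Set C, K.Countable ∧ ∀ᵐ ω ∂(chainLaw init step), ω n ∈ K := by
  induction n with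
  | zero => exact ⟨init.support, init.support_countable, chainLaw_ae_init init step⟩
  | succ n ih =>
    obtain ⟨K, hK, h⟩ := ih
    refine ⟨⋃ c ∈ K, (step c).support, hK.biUnion fun c _ => (step c).support_countable, ?_⟩
    set K' : Set C := ⋃ c ∈ K, (step c).support
    have e := chainLaw_markov init step n (h := fun _ => 1) measurable_const (K'ᶜ.indicator 1)
    have : ∫⁻ ω, 1 * ∑' c, step (ω n) c * K'ᶜ.indicator (1 : C → ℝ≥0∞) c ∂(chainLaw init step)
        = 0 := by
      rw [lintegral_eq_zero_iff' ]
      · filter_upwards [h] with ω hω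
        simp only [one_mul, Pi.zero_apply, ENNReal.tsum_eq_zero]
        intro c
        by_cases hc : step (ω n) c = 0
        · simp [hc]
        · have : c ∈ K' := Set.mem_biUnion hω ((PMF.mem_support_iff _ _).2 hc)
          simp [this]
      · refine Measurable.aemeasurable ?_
        exact (Measurable.of_discrete (f := fun c₀ : C =>
          1 * ∑' c, step c₀ c * K'ᶜ.indicator (1 : C → ℝ≥0∞) c)).comp (measurable_pi_apply n)
    rw [this, lintegral_eq_zero_iff (by
      exact (Measurable.of_discrete (f := fun c : C => 1 * K'ᶜ.indicator (1 : C → ℝ≥0∞) c)).comp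
        (measurable_pi_apply (n + 1)))] at e
    filter_upwards [e] with ω hω
    by_contra hc
    simp [hc] at hω

theorem chainLaw_ae_step (init : PMF C) (step : C → PMF C) :
    ∀ᵐ ω ∂(chainLaw init step), ∀ n, step (ω n) (ω (n + 1)) ≠ 0 := by
  rw [ae_all_iff]
  intro n
  obtain ⟨K, hK, h⟩ := chainLaw_ae_countable init step n
  have h2 : ∀ c ∈ K, ∀ᵐ ω ∂(chainLaw init step), ω n = c → step c (ω (n + 1)) ≠ 0 := by
    intro c _
    let E : Set ((_ : Iic n) → C) := {x | x ⟨n, by simp⟩ = c}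
    have mE : MeasurableSet E :=
      (measurable_pi_apply (X := fun _ : Iic n => C) ⟨n, by simp⟩)
        (MeasurableSet.of_discrete (s := {c}))
    have mE1 : Measurable (E.indicator (1 : ((_ : Iic n) → C) → ℝ≥0∞)) :=
      measurable_one.indicator mE
    have mg : Measurable ({c' | step c c' = 0}.indicator (1 : C → ℝ≥0∞)) := Measurable.of_discrete
    have e := chainLaw_markov init step n mE1 ({c' | step c c' = 0}.indicator 1)
    have : ∀ ω : ℕ → C, E.indicator (1 : ((_ : Iic n) → C) → ℝ≥0∞) (Preorder.frestrictLe n ω) *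
        ∑' c', step (ω n) c' * {c' | step c c' = 0}.indicator (1 : C → ℝ≥0∞) c' = 0 := by
      intro ω
      by_cases hω : ω n = c
      · rw [hω]
        convert mul_zero _
        rw [ENNReal.tsum_eq_zero]
        intro c'
        by_cases hc : step c c' = 0 <;> simp [hc]
      · rw [Set.indicator_of_notMem (by simpa [E] using hω), zero_mul]
    simp_rw [this] at e
    rw [lintegral_zero, lintegral_eq_zero_iff (by fun_prop)] at e
    filter_upwards [e] with ω hω hc h0
    simp [E, hc, h0] at hω
  have h3 := (ae_ball_iff hK).2 h2
  filter_upwards [h, h3] with ω hω hω'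
  exact hω' _ hω rfl

end Chain

/-! ### Isomorphisms and deletion of vertices -/

section Iso

variable {F : Type v} {dep : F → F → Prop}

theorem WdagIso.refl (G : Σ n, Wdag dep n) : WdagIso dep G G := (wdagSetoid dep).refl G

theorem WdagIso.trans {G H K : Σ n, Wdag dep n} (h : WdagIso dep G H) (h' : WdagIso dep H K) :
    WdagIso dep G K := (wdagSetoid dep).trans h h'

theorem WdagIso.card_eq {G H : Σ n, Wdag dep n} (h : WdagIso dep G H) : G.1 = H.1 := by
  obtain ⟨e, -⟩ := h
  simpa using Fintype.card_congr e

theorem Wdag.toClass_eq_iff {G H : Σ n, Wdag dep n} :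
    Wdag.toClass G = Wdag.toClass H ↔ WdagIso dep G H :=
  Quotient.eq (r := wdagSetoid dep)

/-- Two wdags that embed as full subgraphs on the same vertices of a third one are isomorphic. -/
theorem WdagIso.of_range {k m n : ℕ} {G₁ : Wdag dep k} {G₂ : Wdag dep m} {G : Wdag dep n}
    {φ₁ : Fin k → Fin n} {φ₂ : Fin m → Fin n} (i₁ : φ₁.Injective) (i₂ : φ₂.Injective)
    (l₁ : ∀ x, G.label (φ₁ x) = G₁.label x) (l₂ : ∀ x, G.label (φ₂ x) = G₂.label x)
    (e₁ : ∀ x y, G.edge (φ₁ x) (φ₁ y) ↔ G₁.edge x y)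
    (e₂ : ∀ x y, G.edge (φ₂ x) (φ₂ y) ↔ G₂.edge x y) (hr : Set.range φ₁ = Set.range φ₂) :
    WdagIso dep ⟨k, G₁⟩ ⟨m, G₂⟩ := by
  let e : Fin k ≃ Fin m := (Equiv.ofInjective φ₁ i₁).trans
    ((Equiv.setCongr hr).trans (Equiv.ofInjective φ₂ i₂).symm)
  have he : ∀ x, φ₂ (e x) = φ₁ x := fun x => Equiv.apply_ofInjective_symm i₂ _
  exact ⟨e, fun x => by rw [← l₁, ← he, l₂], fun x y => by rw [← e₁, ← he, ← he, e₂]⟩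

theorem Wdag.erase_iso {m n : ℕ} {G : Wdag dep (n + 1)} {H : Wdag dep (m + 1)}
    (e : Fin (n + 1) ≃ Fin (m + 1)) (hl : ∀ x, H.label (e x) = G.label x)
    (he : ∀ x y, H.edge (e x) (e y) ↔ G.edge x y) (x : Fin (n + 1)) :
    WdagIso dep ⟨n, G.erase x⟩ ⟨m, H.erase (e x)⟩ := by
  refine WdagIso.of_range (G := H) (φ₁ := fun y => e (x.succAbove y)) (φ₂ := (e x).succAbove)
    (e.injective.comp Fin.succAbove_right_injective) Fin.succAbove_right_injective
    (fun y => hl _) (fun _ => rfl) (fun _ _ => he _ _) (fun _ _ => Iff.rfl) ?_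
  rw [Fin.range_succAbove, Set.range_comp' e x.succAbove, Fin.range_succAbove,
    Set.image_compl_eq e.bijective, Set.image_singleton]

theorem Wdag.erase_erase_iso {n : ℕ} (G : Wdag dep (n + 2)) {x y : Fin (n + 2)} {x' y' : Fin (n + 1)}
    (hy : x.succAbove y' = y) (hx : y.succAbove x' = x) :
    WdagIso dep ⟨n, (G.erase x).erase y'⟩ ⟨n, (G.erase y).erase x'⟩ := by
  refine WdagIso.of_range (G := G) (φ₁ := fun z => x.succAbove (y'.succAbove z))
    (φ₂ := fun z => y.succAbove (x'.succAbove z))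
    (Fin.succAbove_right_injective.comp Fin.succAbove_right_injective)
    (Fin.succAbove_right_injective.comp Fin.succAbove_right_injective)
    (fun _ => rfl) (fun _ => rfl) (fun _ _ => Iff.rfl) (fun _ _ => Iff.rfl) ?_
  have key : ∀ (a b : Fin (n + 2)) (b' : Fin (n + 1)), a.succAbove b' = b →
      Set.range (fun z => a.succAbove (b'.succAbove z)) = {a, b}ᶜ := by
    rintro a b b' rfl
    ext z
    simp only [Set.mem_range, Set.mem_compl_iff, Set.mem_insert_iff, Set.mem_singleton_iff, not_or]
    constructor
    · rintro ⟨w, rfl⟩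
      exact ⟨Fin.succAbove_ne _ _, fun h =>
        Fin.succAbove_ne _ _ (Fin.succAbove_right_injective h)⟩
    · rintro ⟨h1, h2⟩
      obtain ⟨w, rfl⟩ := Fin.exists_succAbove_eq h1
      obtain ⟨u, rfl⟩ := Fin.exists_succAbove_eq (fun h => h2 (congrArg _ h) : w ≠ b')
      exact ⟨u, rfl⟩
  rw [key _ _ _ hy, key _ _ _ hx, Set.pair_comm]

theorem Wdag.IsSource.not_dep {n : ℕ} {G : Wdag dep n} {x y : Fin n} (hx : G.IsSource x)
    (hy : G.IsSource y) (h : x ≠ y) : ¬ dep (G.label x) (G.label y) := fun hd =>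
  ((G.adj_iff x y h).2 hd).elim (hy x) (hx y)

theorem Wdag.IsSource.erase {n : ℕ} {G : Wdag dep (n + 1)} {x : Fin (n + 1)} {y : Fin n}
    (h : G.IsSource (x.succAbove y)) : (G.erase x).IsSource y := fun _ => h _

end Iso

/-! ### Row sums of `A_H` and charges -/

section Matrices

variable {Ω : Type u}

/-- The action of a nonnegative matrix on a vector. -/
noncomputable def act (M : Ω → Ω → ℝ≥0∞) (v : Ω → ℝ≥0∞) : Ω → ℝ≥0∞ := fun σ => ∑' τ, M σ τ * v τ

theorem act_matMul (M N : Ω → Ω → ℝ≥0∞) (v : Ω → ℝ≥0∞) :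
    act (matMul M N) v = act M (act N v) := by
  funext σ
  simp only [act, matMul, ← ENNReal.tsum_mul_right, ← ENNReal.tsum_mul_left]
  rw [ENNReal.tsum_comm]
  simp only [mul_assoc]

theorem act_mono (M : Ω → Ω → ℝ≥0∞) {v w : Ω → ℝ≥0∞} (h : v ≤ w) : act M v ≤ act M w :=
  fun _ => ENNReal.tsum_le_tsum fun τ => mul_le_mul_right (h τ) _

end Matrices

namespace ResamplingOracle

variable {Ω : Type u} {F : Type v} {R : ResamplingOracle Ω F}

theorem act_A_one_le (R : ResamplingOracle Ω F) (f : F) : act (R.A f) 1 ≤ 1 := by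
  intro σ
  simp only [act, A, Pi.one_apply, mul_one]
  split_ifs with h
  · exact (R.oracle f σ).tsum_coe.le
  · simp

theorem act_A_one_of_mem {f : F} {σ : Ω} (h : σ ∈ R.flaw f) : act (R.A f) 1 σ = 1 := by
  simp only [act, A, Pi.one_apply, mul_one, if_pos h]
  exact (R.oracle f σ).tsum_coe

theorem TCommutative.act_comm (hT : R.TCommutative) {f g : F} (h : ¬ R.dep f g) (v : Ω → ℝ≥0∞) :
    act (R.A f) (act (R.A g) v) = act (R.A g) (act (R.A f) v) := by
  rw [← act_matMul, hT f g h, act_matMul]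

variable (R) in
/-- The vector `A_G 1` of row sums of `A_G`. -/
noncomputable def rowSum (G : Σ n, Wdag R.dep n) : Ω → ℝ≥0∞ := fun σ => ∑' τ, R.wdagMat G.1 G.2 σ τ

theorem rowSum_eq_act (G : Σ n, Wdag R.dep n) : R.rowSum G = act (R.wdagMat G.1 G.2) 1 := by
  funext σ
  simp [rowSum, act]

theorem rowSum_zero (G : Wdag R.dep 0) : R.rowSum ⟨0, G⟩ = 1 := by
  funext σ
  simp [rowSum, wdagMat, matOne]

theorem rowSum_succ {n : ℕ} (G : Wdag R.dep (n + 1)) :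
    R.rowSum ⟨n + 1, G⟩ = act (R.A (G.label G.exists_source.choose))
      (R.rowSum ⟨n, G.erase G.exists_source.choose⟩) := by
  rw [rowSum_eq_act, rowSum_eq_act, ← act_matMul]
  rfl

theorem dominated_iff {f : F} {G : Σ n, Wdag R.dep n} :
    R.Dominated f G ↔ act (R.A f) (R.rowSum G) ≤ R.rowSum G := by
  rw [rowSum_eq_act, ← act_matMul]
  simp [Dominated, act, Pi.le_def]

/-- Invariance under isomorphism and independence of the source depend on each other, so one
induction proves both. For two sources, each is still a source after the other is deleted; both can
be peeled off in either order. -/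
theorem TCommutative.rowSum_aux (hT : R.TCommutative) (n : ℕ) :
    (∀ G H : Wdag R.dep n, WdagIso R.dep ⟨n, G⟩ ⟨n, H⟩ → R.rowSum ⟨n, G⟩ = R.rowSum ⟨n, H⟩) ∧
    ∀ (G : Wdag R.dep (n + 1)) (x : Fin (n + 1)), G.IsSource x →
      R.rowSum ⟨n + 1, G⟩ = act (R.A (G.label x)) (R.rowSum ⟨n, G.erase x⟩) := by
  induction n with
  | zero =>
    refine ⟨fun G H _ => by rw [rowSum_zero, rowSum_zero], fun G x _ => ?_⟩
    rw [rowSum_succ, (by ext; omega : x = G.exists_source.choose)]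
  | succ n ih =>
    obtain ⟨hiso, hsrc⟩ := ih
    constructor
    · rintro G H ⟨e, hl, he⟩
      obtain ⟨x, hx⟩ := G.exists_source
      have hex : H.IsSource (e x) := fun y hy =>
        hx (e.symm y) ((he _ _).1 (by simpa using hy))
      rw [hsrc G x hx, hsrc H (e x) hex, hl, hiso _ _ (Wdag.erase_iso e hl he x)]
    · intro G y hy
      rw [rowSum_succ]
      have hx := G.exists_source.choose_spec
      set x := G.exists_source.choose
      by_cases hxy : x = y
      · rw [hxy]
      obtain ⟨y', hy'⟩ := Fin.exists_succAbove_eq (Ne.symm hxy)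
      obtain ⟨x', hx'⟩ := Fin.exists_succAbove_eq hxy
      rw [hsrc (G.erase x) y' (Wdag.IsSource.erase (hy'.symm ▸ hy)),
        hsrc (G.erase y) x' (Wdag.IsSource.erase (hx'.symm ▸ hx)),
        hiso _ _ (G.erase_erase_iso hy' hx')]
      change act _ (act (R.A (G.label (x.succAbove y'))) _) =
        act _ (act (R.A (G.label (y.succAbove x'))) _)
      -- Distinct sources are not adjacent, so their labels are unrelated and the matrices commute.
      rw [hy', hx', hT.act_comm (hx.not_dep hy hxy)]

theorem TCommutative.rowSum_of_isSource (hT : R.TCommutative) {n : ℕ} (G : Wdag R.dep (n + 1))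
    {x : Fin (n + 1)} (hx : G.IsSource x) :
    R.rowSum ⟨n + 1, G⟩ = act (R.A (G.label x)) (R.rowSum ⟨n, G.erase x⟩) :=
  (hT.rowSum_aux n).2 G x hx

theorem TCommutative.rowSum_congr (hT : R.TCommutative) {G H : Σ n, Wdag R.dep n}
    (h : WdagIso R.dep G H) : R.rowSum G = R.rowSum H := by
  obtain ⟨n, G⟩ := G
  obtain ⟨m, H⟩ := H
  obtain rfl : n = m := h.card_eq
  exact (hT.rowSum_aux n).1 G H h

/-- A flaw that is unrelated to all labels of a wdag is dominated by it. -/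
theorem TCommutative.dominated_of_unrelated (hT : R.TCommutative) {f : F} {n : ℕ}
    (G : Wdag R.dep n) (h : ∀ x, ¬ R.dep f (G.label x)) : R.Dominated f ⟨n, G⟩ := by
  rw [dominated_iff]
  induction n with
  | zero => rw [rowSum_zero]; exact R.act_A_one_le f
  | succ n ih =>
    -- `A_f` moves past every factor until it meets the all-ones vector, where `A_f 1 ≤ 1`.
    rw [rowSum_succ, hT.act_comm (h _)]
    exact act_mono _ (ih _ fun x => h _)

/-- The charge is precisely the least factor in `μᵀ A_f ≤ γ_f μᵀ`; iterating this along a wdag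
produces the weight. -/
theorem tsum_init_mul_A_le (hμ : ∀ σ, R.init σ ≠ 0) (f : F) (τ : Ω) :
    ∑' σ, R.init σ * R.A f σ τ ≤ R.charge f * R.init τ := by
  have h : ∑' σ, R.init σ / R.init τ * R.A f σ τ ≤ R.charge f :=
    le_iSup (fun τ => ∑' σ, R.init σ / R.init τ * R.A f σ τ) τ
  calc ∑' σ, R.init σ * R.A f σ τ = (∑' σ, R.init σ / R.init τ * R.A f σ τ) * R.init τ := by
        rw [← ENNReal.tsum_mul_right]
        refine tsum_congr fun σ => ?_
        rw [mul_right_comm, ENNReal.div_mul_cancel (hμ τ) (R.init.apply_ne_top τ)]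
    _ ≤ _ := mul_le_mul_left h _

theorem tsum_init_mul_rowSum_le (hμ : ∀ σ, R.init σ ≠ 0) {n : ℕ} (G : Wdag R.dep n) :
    ∑' σ, R.init σ * R.rowSum ⟨n, G⟩ σ ≤ G.weight R.charge := by
  induction n with
  | zero => simp [rowSum_zero, Wdag.weight, R.init.tsum_coe]
  | succ n ih =>
    rw [rowSum_succ, Wdag.weight, Fin.prod_univ_succAbove _ G.exists_source.choose]
    set x := G.exists_source.choose
    calc ∑' σ, R.init σ * act (R.A (G.label x)) (R.rowSum ⟨n, G.erase x⟩) σ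
        = ∑' τ, (∑' σ, R.init σ * R.A (G.label x) σ τ) * R.rowSum ⟨n, G.erase x⟩ τ := by
          simp only [act, ← ENNReal.tsum_mul_right, ← ENNReal.tsum_mul_left]
          rw [ENNReal.tsum_comm]
          simp only [mul_assoc]
      _ ≤ ∑' τ, R.charge (G.label x) * (R.init τ * R.rowSum ⟨n, G.erase x⟩ τ) := by
          refine ENNReal.tsum_le_tsum fun τ => ?_
          rw [← mul_assoc]
          exact mul_le_mul_left (tsum_init_mul_A_le hμ _ τ) _
      _ ≤ R.charge (G.label x) * (G.erase x).weight R.charge := by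
          rw [ENNReal.tsum_mul_left]
          exact mul_le_mul_right (ih _) _

end ResamplingOracle

/-! ### Expectations under composed distributions -/

section PMF

variable {α β : Type*}

theorem tsum_pmf_bind (p : PMF α) (q : α → PMF β) (g : β → ℝ≥0∞) :
    ∑' b, p.bind q b * g b = ∑' a, p a * ∑' b, q a b * g b := by
  simp only [PMF.bind_apply, ← ENNReal.tsum_mul_right, ← ENNReal.tsum_mul_left]
  rw [ENNReal.tsum_comm]
  simp only [mul_assoc]

theorem tsum_pmf_pure (a : α) (g : α → ℝ≥0∞) : ∑' b, PMF.pure a b * g b = g a := by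
  rw [tsum_eq_single a fun b hb => by simp [PMF.pure_apply, hb]]
  simp

theorem tsum_pmf_map (p : PMF α) (φ : α → β) (g : β → ℝ≥0∞) :
    ∑' b, p.map φ b * g b = ∑' a, p a * g (φ a) := by
  rw [PMF.map, tsum_pmf_bind]
  simp only [Function.comp, tsum_pmf_pure]

end PMF

/-! ### Adding and cancelling a source -/

namespace Wdag

variable {F : Type v} {dep : F → F → Prop} {n : ℕ}

theorem addNode_isSource_zero (hs : ∀ f g, dep f g → dep g f) (f : F) (G : Wdag dep n) :
    (G.addNode hs f).IsSource 0 := fun y hy => by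
  induction y using Fin.cases <;> exact hy.elim

theorem addNode_label_zero (hs : ∀ f g, dep f g → dep g f) (f : F) (G : Wdag dep n) :
    (G.addNode hs f).label 0 = f := rfl

theorem addNode_edge_zero (hs : ∀ f g, dep f g → dep g f) (f : F) (G : Wdag dep n) (x : Fin n) :
    (G.addNode hs f).edge 0 x.succ ↔ dep (G.label x) f := Iff.rfl

theorem addNode_not_edge_to_zero (hs : ∀ f g, dep f g → dep g f) (f : F) (G : Wdag dep n)
    (x : Fin (n + 1)) : ¬ (G.addNode hs f).edge x 0 := G.addNode_isSource_zero hs f x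

theorem addNode_erase_zero (hs : ∀ f g, dep f g → dep g f) (f : F) (G : Wdag dep n) :
    WdagIso dep ⟨n, (G.addNode hs f).erase 0⟩ ⟨n, G⟩ :=
  ⟨Equiv.refl _, fun _ => rfl, fun _ _ => Iff.rfl⟩

/-- A new source can be cancelled. -/
theorem addNode_cancel {m : ℕ} (hs : ∀ f g, dep f g → dep g f) (hr : ∀ f, dep f f) (f : F)
    {G : Wdag dep n} {H : Wdag dep m}
    (h : WdagIso dep ⟨n + 1, G.addNode hs f⟩ ⟨m + 1, H.addNode hs f⟩) :
    WdagIso dep ⟨n, G⟩ ⟨m, H⟩ := by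
  obtain ⟨e, hl, he⟩ := h
  -- Otherwise two distinct sources would both be labelled `f`, which is related to itself.
  have h0 : e 0 = 0 := by
    by_contra hne
    have hsrc : (H.addNode hs f).IsSource (e 0) := fun y hy =>
      G.addNode_isSource_zero hs f (e.symm y) ((he _ _).1 (by simpa using hy))
    refine hsrc.not_dep (H.addNode_isSource_zero hs f) hne ?_
    rw [hl]
    exact hr f
  have := Wdag.erase_iso e hl he 0
  rw [h0] at this
  exact (addNode_erase_zero hs f G).symm.trans (this.trans (addNode_erase_zero hs f H))

end Wdag

/-! ### The potential, and the probability that a wdag appears -/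

namespace ResamplingOracle

variable {Ω : Type u} {F : Type v} {R : ResamplingOracle Ω F}

variable (R) in
/-- The wdag generated with the rule `Q₁`. -/
noncomputable abbrev witness (l : List F) : Σ n, Wdag R.dep n := R.genWitness R.ruleOne l

theorem witness_singleton (f : F) :
    R.witness [f] = ⟨1, Wdag.addNode R.dep_symm f Wdag.empty⟩ := rfl

variable (R) in
/-- The condition under which the generation of a wdag adds a node labelled `f`. -/
def Adds (f : F) (G : Σ n, Wdag R.dep n) : Prop := R.ruleOne f G ∨ ¬ R.Dominated f G

theorem witness_cons_of_adds {f : F} {l : List F} (hl : l ≠ []) (h : R.Adds f (R.witness l)) :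
    R.witness (f :: l) = ⟨_, Wdag.addNode R.dep_symm f (R.witness l).2⟩ := by
  cases l with
  | nil => exact (hl rfl).elim
  | cons g l => exact if_pos h

theorem witness_cons_of_not_adds {f : F} {l : List F} (hl : l ≠ [])
    (h : ¬ R.Adds f (R.witness l)) : R.witness (f :: l) = R.witness l := by
  cases l with
  | nil => exact (hl rfl).elim
  | cons g l => exact if_neg h

theorem ruleOne_of_iso_addNode {f : F} {G : Σ n, Wdag R.dep n} {n : ℕ} {H : Wdag R.dep n}
    (h : WdagIso R.dep ⟨n + 1, H.addNode R.dep_symm f⟩ G) : R.ruleOne f G := by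
  obtain ⟨e, hl, he⟩ := h
  refine ⟨e 0, fun y hy => H.addNode_isSource_zero R.dep_symm f (e.symm y)
    ((he _ _).1 (by simpa using hy)), ?_⟩
  rw [hl]
  exact R.dep_refl f

/-- The decision whether `f` was added can be recovered from the result. If it was added on one side
only, then the wdag on the other side, isomorphic to the enlarged one, has a source labelled `f`,
and `Q₁` would have forced an addition there too. -/
theorem witness_cons_cancel {f : F} {a b : List F} (ha : a ≠ []) (hb : b ≠ [])
    (h : WdagIso R.dep (R.witness (f :: a)) (R.witness (f :: b))) :
    WdagIso R.dep (R.witness a) (R.witness b) := by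
  by_cases h1 : R.Adds f (R.witness a) <;> by_cases h2 : R.Adds f (R.witness b)
  · rw [witness_cons_of_adds ha h1, witness_cons_of_adds hb h2] at h
    exact Wdag.addNode_cancel R.dep_symm R.dep_refl f h
  · rw [witness_cons_of_adds ha h1, witness_cons_of_not_adds hb h2] at h
    exact (h2 (Or.inl (ruleOne_of_iso_addNode h))).elim
  · rw [witness_cons_of_not_adds ha h1, witness_cons_of_adds hb h2] at h
    exact (h1 (Or.inl (ruleOne_of_iso_addNode h.symm))).elim
  · rwa [witness_cons_of_not_adds ha h1, witness_cons_of_not_adds hb h2] at h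

theorem witness_append_cancel {l a b : List F} (ha : a ≠ []) (hb : b ≠ [])
    (h : WdagIso R.dep (R.witness (l ++ a)) (R.witness (l ++ b))) :
    WdagIso R.dep (R.witness a) (R.witness b) := by
  induction l with
  | nil => exact h
  | cons f l ih => exact ih (witness_cons_cancel (by simp [ha]) (by simp [hb]) h)

theorem rowSum_witness_singleton (f : F) : R.rowSum (R.witness [f]) = act (R.A f) 1 := by
  rw [witness_singleton, rowSum_succ, rowSum_zero]
  congr 2
  exact congrArg (Wdag.addNode R.dep_symm f Wdag.empty).label
    (by ext; omega : _ = (0 : Fin 1))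

/-- This is why nodes may be skipped only for dominated flaws: an added node gives equality, and a
skipped one gives the definition of domination. -/
theorem TCommutative.act_rowSum_witness_le (hT : R.TCommutative) (f : F) {l : List F}
    (hl : l ≠ []) : act (R.A f) (R.rowSum (R.witness l)) ≤ R.rowSum (R.witness (f :: l)) := by
  by_cases h : R.Adds f (R.witness l)
  · rw [witness_cons_of_adds hl h, hT.rowSum_of_isSource _ (Wdag.addNode_isSource_zero _ _ _),
      hT.rowSum_congr (Wdag.addNode_erase_zero _ _ _)]
    exact le_rfl
  · rw [witness_cons_of_not_adds hl h, ← dominated_iff]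
    by_contra h'
    exact h (Or.inr h')

/-- The flaws resampled so far, in chronological order. -/
def _root_.LocalSearch.Config.labels (c : Config Ω F) : List F := (c.past.map Prod.snd).reverse

theorem labels_next (c : Config Ω F) (f : F) (τ : Ω) :
    (R.next c f τ).labels = c.labels ++ [f] := by
  simp [next, Config.labels]

theorem active_start_subset (σ : Ω) :
    (R.start σ).active ⊆ {g | (R.start σ).state ∈ R.flaw g} := subset_rfl

theorem active_next_subset (c : Config Ω F) (f : F) (τ : Ω) :
    (R.next c f τ).active ⊆ {g | (R.next c f τ).state ∈ R.flaw g} := by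
  simp only [next]
  split_ifs
  · exact fun g hg => hg.2.1
  · exact subset_rfl

variable (R) in
/-- An upper bound for the probability that the wdag `H` will appear, given the current
configuration. -/
noncomputable def potential (H : Σ n, Wdag R.dep n) (c : Config Ω F) : ℝ≥0∞ :=
  if c.active ⊆ {g | c.state ∈ R.flaw g} then
    ⨆ (l : List F) (_ : l ≠ [] ∧ WdagIso R.dep (R.witness (c.labels ++ l)) H),
      R.rowSum (R.witness l) c.state
  else ∞

/-- Since `f` holds, averaging a vector over the outcome of resampling `f` is applying `A_f` to it.
If `l` completes `H` after the resampling, then `f :: l` completes it before. -/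
theorem TCommutative.potential_next_le (hT : R.TCommutative) (H : Σ n, Wdag R.dep n)
    (c : Config Ω F) (hc : c.active ⊆ {g | c.state ∈ R.flaw g}) {f : F} (hf : f ∈ c.active) :
    ∑' τ, R.oracle f c.state τ * R.potential H (R.next c f τ) ≤ R.potential H c := by
  by_cases h : ∃ l, l ≠ [] ∧ WdagIso R.dep (R.witness (c.labels ++ [f] ++ l)) H
  · obtain ⟨l, hl, hH⟩ := h
    have h1 : ∀ τ, R.potential H (R.next c f τ) ≤ R.rowSum (R.witness l) τ := fun τ => by
      rw [potential, if_pos (active_next_subset c f τ), labels_next]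
      refine iSup₂_le fun l' hl' => ?_
      -- By cancellation all competitors `l'` in the supremum give the same row sum as `l`.
      rw [hT.rowSum_congr (witness_append_cancel hl'.1 hl (hl'.2.trans hH.symm))]
      rfl
    have h2 : ∑' τ, R.oracle f c.state τ * R.potential H (R.next c f τ) ≤
        act (R.A f) (R.rowSum (R.witness l)) c.state := by
      refine ENNReal.tsum_le_tsum fun τ => ?_
      rw [A, if_pos (show c.state ∈ R.flaw f from hc hf)]
      exact mul_le_mul_right (h1 τ) _
    refine h2.trans ((hT.act_rowSum_witness_le f hl _).trans ?_)
    rw [potential, if_pos hc]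
    exact le_iSup₂_of_le (f :: l) ⟨by simp, by simpa using hH⟩ le_rfl
  · have : ∀ τ, R.potential H (R.next c f τ) = 0 := fun τ => by
      rw [potential, if_pos (active_next_subset c f τ), labels_next]
      simp only [ENNReal.iSup_eq_zero]
      exact fun l hl => (h ⟨l, hl⟩).elim
    simp [this]

theorem TCommutative.potential_step_le (hT : R.TCommutative) (S : Selector Ω F)
    (H : Σ n, Wdag R.dep n) (c : Config Ω F) :
    ∑' c', R.step S c c' * R.potential H c' ≤ R.potential H c := by
  by_cases hc : c.active ⊆ {g | c.state ∈ R.flaw g}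
  · rw [step]
    split_ifs with h
    · rw [tsum_pmf_bind]
      calc _ ≤ ∑' f, S.pick c h f * R.potential H c := by
            refine ENNReal.tsum_le_tsum fun f => ?_
            by_cases hf : S.pick c h f = 0
            · simp [hf]
            · rw [tsum_pmf_map]
              exact mul_le_mul_right (hT.potential_next_le H c hc
                (S.pick_mem c h f ((PMF.mem_support_iff _ _).2 hf))) _
        _ = _ := by rw [ENNReal.tsum_mul_right, PMF.tsum_coe, one_mul]
    · rw [tsum_pmf_pure]
  -- Configurations with an active flaw that does not hold are never reached; the value `∞` makes
  -- the inequality true there as well.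
  · rw [potential, if_neg hc]
    exact le_top

variable (R) in
/-- The configurations from which a single resampling would complete the wdag `H`. -/
def completing (H : WdagClass R.dep) : Set (Config Ω F) :=
  {c | ∃ f, c.state ∈ R.flaw f ∧ Wdag.toClass (R.witness (c.labels ++ [f])) = H}

variable (R) in
/-- The executions in which the wdag `H` could be completed at some time. -/
def appears (H : WdagClass R.dep) : Set (ℕ → Config Ω F) := {ω | ∃ n, ω n ∈ R.completing H}

instance : DiscreteMeasurableSpace (Config Ω F) := ⟨fun _ => trivial⟩

theorem measurableSet_appears (H : WdagClass R.dep) : MeasurableSet (R.appears H) :=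
  chainLaw_hit_measurable _

instance (S : Selector Ω F) : IsProbabilityMeasure (R.runLaw S) :=
  inferInstanceAs (IsProbabilityMeasure (chainLaw _ _))

/-- A wdag appears with probability at most its weight. -/
theorem TCommutative.runLaw_appears_le (hT : R.TCommutative) (hμ : ∀ σ, R.init σ ≠ 0)
    (S : Selector Ω F) (H : WdagClass R.dep) : R.runLaw S (R.appears H) ≤ H.weight R.charge := by
  obtain ⟨G, rfl⟩ : ∃ G, Wdag.toClass G = H := Quotient.exists_rep H
  refine (chainLaw_hit_le _ _ (R.potential G) (hT.potential_step_le S G) _ ?_).trans ?_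
  · rintro c ⟨f, hf, hH⟩
    rw [potential]
    split_ifs
    · refine le_iSup₂_of_le [f] ⟨by simp, Wdag.toClass_eq_iff.1 hH⟩ ?_
      rw [rowSum_witness_singleton, act_A_one_of_mem hf]
    · exact le_top
  · rw [tsum_pmf_map]
    refine le_trans (ENNReal.tsum_le_tsum fun σ => mul_le_mul_right ?_ _)
      (tsum_init_mul_rowSum_le hμ G.2)
    -- Initially the past is empty, so every competitor generates `G` itself.
    rw [potential, if_pos (active_start_subset σ)]
    exact iSup₂_le fun l hl => (congrFun (hT.rowSum_congr hl.2) σ).le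

end ResamplingOracle

/-! ### Heights, depth and sinks -/

namespace Wdag

variable {F : Type v} {dep : F → F → Prop} {n : ℕ}

/-- All directed paths have at most `h + 1` vertices, and paths with `h + 1` vertices start in a
vertex with a label in `s`. -/
def HeightLE (G : Wdag dep n) (h : ℕ) (s : List F) : Prop :=
  ∃ r : Fin n → ℕ, (∀ x y, G.edge x y → r y < r x) ∧ ∀ x, r x ≤ h ∧ (r x = h → G.label x ∈ s)

/-- Some source with a label in `s` is the beginning of a path with `h + 1` vertices. -/
def HeightGE (G : Wdag dep n) (h : ℕ) (s : List F) : Prop :=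
  ∃ x p, G.IsSource x ∧ G.label x ∈ s ∧ (x :: p).IsChain G.edge ∧ p.length = h

theorem HeightLE.succ {G : Wdag dep n} {h : ℕ} {s : List F} (H : G.HeightLE h s) :
    G.HeightLE (h + 1) [] := by
  obtain ⟨r, h1, h2⟩ := H
  exact ⟨r, h1, fun x => ⟨(h2 x).1.trans (by omega), fun hx => by have := (h2 x).1; omega⟩⟩

theorem HeightLE.mono {G : Wdag dep n} {h : ℕ} {s t : List F} (H : G.HeightLE h s) (hst : s ⊆ t) :
    G.HeightLE h t := by
  obtain ⟨r, h1, h2⟩ := H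
  exact ⟨r, h1, fun x => ⟨(h2 x).1, fun hx => hst ((h2 x).2 hx)⟩⟩

theorem HeightGE.mono {G : Wdag dep n} {h : ℕ} {s t : List F} (H : G.HeightGE h s) (hst : s ⊆ t) :
    G.HeightGE h t := by
  obtain ⟨x, p, h1, h2, h3⟩ := H
  exact ⟨x, p, h1, hst h2, h3⟩

theorem HeightLE.addNode {G : Wdag dep n} {h : ℕ} {s : List F} (H : G.HeightLE h s)
    (hs : ∀ f g, dep f g → dep g f) {f : F} (hf : ∀ g ∈ s, ¬ dep g f) :
    (G.addNode hs f).HeightLE h (f :: s) := by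
  obtain ⟨r, h1, h2⟩ := H
  refine ⟨Fin.cons h r, fun x y hxy => ?_, fun x => ?_⟩
  · induction y using Fin.cases with
    | zero => exact (addNode_not_edge_to_zero hs f G x hxy).elim
    | succ y =>
      induction x using Fin.cases with
      | zero =>
        rw [Fin.cons_zero, Fin.cons_succ]
        exact lt_of_le_of_ne (h2 y).1 fun he => hf _ ((h2 y).2 he) hxy
      | succ x =>
        rw [Fin.cons_succ, Fin.cons_succ]
        exact h1 x y hxy
  · induction x using Fin.cases with
    | zero => exact ⟨le_rfl, fun _ => List.mem_cons_self ..⟩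
    | succ x => exact ⟨(h2 x).1, fun hx => List.mem_cons_of_mem _ ((h2 x).2 hx)⟩

theorem HeightGE.addNode {G : Wdag dep n} {h : ℕ} {s : List F} (H : G.HeightGE h s)
    (hs : ∀ f g, dep f g → dep g f) {f : F} (hf : ∀ g ∈ s, ¬ dep g f) :
    (G.addNode hs f).HeightGE h s := by
  obtain ⟨x, p, h1, h2, h3, h4⟩ := H
  refine ⟨x.succ, p.map Fin.succ, fun y hy => ?_, h2, ?_, by simpa using h4⟩
  · induction y using Fin.cases with
    | zero => exact hf _ h2 hy
    | succ y => exact h1 y hy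
  · rw [← List.map_cons, List.isChain_map]
    exact h3

theorem HeightGE.addNode_related {G : Wdag dep n} {h : ℕ} {a : F} (H : G.HeightGE h [a])
    (hs : ∀ f g, dep f g → dep g f) {f : F} (hf : dep a f) :
    (G.addNode hs f).HeightGE (h + 1) [f] := by
  obtain ⟨x, p, -, h2, h3, h4⟩ := H
  refine ⟨0, (x :: p).map Fin.succ, G.addNode_isSource_zero hs f, by simp [addNode_label_zero], ?_,
    by simpa using h4⟩
  rw [List.map_cons, List.isChain_cons_cons]
  refine ⟨?_, ?_⟩
  · rw [addNode_edge_zero, List.mem_singleton.1 h2]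
    exact hf
  · rw [← List.map_cons, List.isChain_map]
    exact h3

theorem length_le_of_rank {G : Wdag dep n} {r : Fin n → ℕ} (hr : ∀ x y, G.edge x y → r y < r x)
    {x : Fin n} {p : List (Fin n)} (h : (x :: p).IsChain G.edge) : p.length ≤ r x := by
  induction p generalizing x with
  | nil => simp
  | cons y p ih =>
    rw [List.isChain_cons_cons] at h
    have := ih h.2
    have := hr _ _ h.1
    simp only [List.length_cons]
    omega

/-- Heights count edges while the depth counts vertices, hence the `+ 1`. -/
theorem depth_eq_of_height {G : Wdag dep n} {h : ℕ} {s t : List F} (h1 : G.HeightLE h s)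
    (h2 : G.HeightGE h t) : G.depth = h + 1 := by
  obtain ⟨r, hr, hr'⟩ := h1
  obtain ⟨x, p, -, -, hp, hl⟩ := h2
  refine IsGreatest.csSup_eq ⟨⟨x :: p, hp, by simp [hl]⟩, ?_⟩
  rintro k ⟨q, hq, rfl⟩
  cases q with
  | nil => simp
  | cons y q =>
    have := length_le_of_rank hr hq
    have := (hr' y).1
    simp only [List.length_cons]
    omega

theorem depth_le_card (G : Wdag dep n) : G.depth ≤ n := by
  refine csSup_le ⟨0, [], by simp⟩ ?_
  rintro k ⟨p, hp, rfl⟩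
  have : IsTrans (Fin n) (Relation.TransGen G.edge) := ⟨fun _ _ _ => Relation.TransGen.trans⟩
  have h1 : p.Pairwise (Relation.TransGen G.edge) :=
    List.isChain_iff_pairwise.1 (hp.imp fun _ _ => Relation.TransGen.single)
  have h2 : p.Nodup := h1.imp (S := (· ≠ ·)) fun {a b} hab he =>
    G.acyclic a (by rwa [← he] at hab)
  simpa using h2.length_le_card

theorem sinkLabels_addNode (hs : ∀ f g, dep f g → dep g f) {f : F} {G : Wdag dep n}
    (h : ∃ x, dep (G.label x) f) : (G.addNode hs f).sinkLabels = G.sinkLabels := by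
  ext g
  constructor
  · rintro ⟨x, hx, rfl⟩
    induction x using Fin.cases with
    | zero =>
      obtain ⟨y, hy⟩ := h
      exact (hx y.succ hy).elim
    | succ x => exact ⟨x, fun y hy => hx y.succ hy, rfl⟩
  · rintro ⟨x, hx, rfl⟩
    refine ⟨x.succ, fun y hy => ?_, rfl⟩
    induction y using Fin.cases with
    | zero => exact addNode_not_edge_to_zero hs f G _ hy
    | succ y => exact hx y hy

end Wdag

/-! ### Round structure: sink and depth of the generated wdags -/

namespace ResamplingOracle

variable {Ω : Type u} {F : Type v} {R : ResamplingOracle Ω F}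

theorem TCommutative.sinkLabels_witness (hT : R.TCommutative) (l : List F) (f : F) :
    (R.witness (l ++ [f])).2.sinkLabels = {f} := by
  induction l with
  | nil =>
    ext g
    constructor
    · rintro ⟨x, -, rfl⟩
      obtain rfl : x = (0 : Fin 1) := Subsingleton.elim (α := Fin 1) _ _
      rfl
    · rintro rfl
      refine ⟨(0 : Fin 1), fun (y : Fin 1) hy => ?_, rfl⟩
      obtain rfl : y = (0 : Fin 1) := Subsingleton.elim _ _
      exact hy
  | cons g l ih =>
    rw [List.cons_append]
    by_cases h : R.Adds g (R.witness (l ++ [f]))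
    · rw [witness_cons_of_adds (by simp) h]
      refine (Wdag.sinkLabels_addNode R.dep_symm ?_).trans ih
      -- An added node always has an outgoing edge, so it is no sink: under `Q₁` it is related to a
      -- source, and a flaw that is not dominated is related to some label.
      rcases h with ⟨x, -, hx⟩ | h
      · exact ⟨x, hx⟩
      · by_contra! hx
        exact h (hT.dominated_of_unrelated _ fun x hd => hx x (R.dep_symm _ _ hd))
    · rw [witness_cons_of_not_adds (by simp) h, ih]

variable (R) in
/-- Every flaw of the second list is related to a flaw of the first one. -/
def Linked (B B' : List F) : Prop := ∀ g ∈ B', ∃ h ∈ B, R.dep g h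

variable (R) in
/-- The flaws of a list are mutually unrelated. -/
def Unrelated (B : List F) : Prop := B.Pairwise fun f g => ¬ R.dep f g

/-- The old vertices have rank below `h`, and the new ones are mutually nonadjacent, so all of them
can receive rank `h`. -/
theorem heightLE_witness_append {l : List F} (hl : l ≠ []) {h : ℕ}
    (H : (R.witness l).2.HeightLE h []) {B : List F} (hB : R.Unrelated B) :
    (R.witness (B ++ l)).2.HeightLE h B := by
  induction B with
  | nil => exact H
  | cons f B ih =>
    obtain ⟨h1, h2⟩ := List.pairwise_cons.1 hB
    rw [List.cons_append]
    by_cases ha : R.Adds f (R.witness (B ++ l))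
    · rw [witness_cons_of_adds (by simp [hl]) ha]
      exact (ih h2).addNode R.dep_symm fun g hg hd => h1 g hg (R.dep_symm _ _ hd)
    · rw [witness_cons_of_not_adds (by simp [hl]) ha]
      exact (ih h2).mono (by simp)

/-- Let `a` be the label of a source that begins a long path. Reading `B` backward, this vertex
remains a source until a flaw related to `a` is met; `Q₁` then forces a node, which lengthens the
path. The remaining flaws of `B` are unrelated to that node, so it stays a source. -/
theorem heightGE_witness_append {l : List F} (hl : l ≠ []) {h : ℕ} {s : List F}
    (H : (R.witness l).2.HeightGE h s) {B : List F} (hB : R.Unrelated B) (hs : R.Linked B s) :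
    (R.witness (B ++ l)).2.HeightGE (h + 1) B := by
  obtain ⟨a, ha, H⟩ : ∃ a ∈ s, (R.witness l).2.HeightGE h [a] := by
    obtain ⟨x, p, h1, h2, h3⟩ := H
    exact ⟨_, h2, x, p, h1, by simp, h3⟩
  have key : (R.witness (B ++ l)).2.HeightGE (h + 1) B ∨
      ((∀ g ∈ B, ¬ R.dep a g) ∧ (R.witness (B ++ l)).2.HeightGE h [a]) := by
    clear hs
    induction B with
    | nil => exact Or.inr ⟨by simp, H⟩
    | cons f B ih =>
      obtain ⟨h1, h2⟩ := List.pairwise_cons.1 hB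
      rw [List.cons_append]
      rcases ih h2 with ih | ⟨ih1, ih2⟩
      · left
        by_cases had : R.Adds f (R.witness (B ++ l))
        · rw [witness_cons_of_adds (by simp [hl]) had]
          exact (ih.addNode R.dep_symm fun g hg hd => h1 g hg (R.dep_symm _ _ hd)).mono (by simp)
        · rw [witness_cons_of_not_adds (by simp [hl]) had]
          exact ih.mono (by simp)
      · by_cases haf : R.dep a f
        · left
          have had : R.Adds f (R.witness (B ++ l)) := by
            obtain ⟨x, p, h1, h2, -⟩ := ih2
            exact Or.inl ⟨x, h1, by rwa [List.mem_singleton.1 h2]⟩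
          rw [witness_cons_of_adds (by simp [hl]) had]
          exact (ih2.addNode_related R.dep_symm haf).mono (by simp)
        · right
          refine ⟨by simpa [haf] using ih1, ?_⟩
          by_cases had : R.Adds f (R.witness (B ++ l))
          · rw [witness_cons_of_adds (by simp [hl]) had]
            exact ih2.addNode R.dep_symm (by simpa using haf)
          · rw [witness_cons_of_not_adds (by simp [hl]) had]
            exact ih2
  refine key.resolve_right fun h' => ?_
  obtain ⟨b, hb, hab⟩ := hs a ha
  exact h'.1 b hb hab

theorem height_witness_flatten (f : F) (L : List (List F))
    (hL : (L ++ [[f]]).IsChain R.Linked) (hU : ∀ B ∈ L, R.Unrelated B) :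
    ∀ B ∈ (L ++ [[f]]).head?, (R.witness (L.flatten ++ [f])).2.HeightLE L.length B ∧
      (R.witness (L.flatten ++ [f])).2.HeightGE L.length B := by
  induction L with
  | nil =>
    intro B hB
    obtain rfl : [f] = B := by simpa using hB
    constructor
    · refine ⟨fun _ => 0, fun (x : Fin 1) (y : Fin 1) hxy => ?_, fun (x : Fin 1) => ⟨le_rfl, ?_⟩⟩
      · obtain rfl : y = (0 : Fin 1) := Subsingleton.elim _ _
        exact (Wdag.addNode_not_edge_to_zero R.dep_symm f _ x hxy).elim
      · obtain rfl : x = (0 : Fin 1) := Subsingleton.elim _ _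
        exact fun _ => List.mem_cons_self ..
    · exact ⟨(0 : Fin 1), [], Wdag.addNode_isSource_zero R.dep_symm f _, List.mem_cons_self ..,
        List.isChain_singleton _, rfl⟩
  | cons B₀ L ih =>
    rw [List.cons_append, List.isChain_cons] at hL
    intro B hB
    obtain rfl : B₀ = B := by simpa using hB
    obtain ⟨B₁, hB₁⟩ : ∃ B₁, B₁ ∈ (L ++ [[f]]).head? := by cases L <;> simp
    obtain ⟨h1, h2⟩ := ih hL.2 (fun B hB => hU B (by simp [hB])) B₁ hB₁
    rw [List.flatten_cons, List.append_assoc, List.length_cons]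
    exact ⟨heightLE_witness_append (by simp) h1.succ (hU _ (by simp)),
      heightGE_witness_append (by simp) h2 (hU _ (by simp)) (hL.1 _ hB₁)⟩

theorem depth_witness_flatten (f : F) (L : List (List F))
    (hL : (L ++ [[f]]).IsChain R.Linked) (hU : ∀ B ∈ L, R.Unrelated B) :
    (R.witness (L.flatten ++ [f])).2.depth = L.length + 1 := by
  obtain ⟨B, hB⟩ : ∃ B, B ∈ (L ++ [[f]]).head? := by cases L <;> simp
  obtain ⟨h1, h2⟩ := height_witness_flatten f L hL hU B hB
  exact Wdag.depth_eq_of_height h1 h2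

variable (R) in
/-- The configuration `c` is reachable, `L` lists the flaws resampled in the completed rounds, and
`B` lists those resampled in the current round. -/
structure Reached (c : Config Ω F) (L : List (List F)) (B : List F) : Prop where
  labels_eq : c.labels = L.flatten ++ B
  round_eq : c.round = L.length + 1
  linked : (L ++ [B]).IsChain R.Linked
  unrelated : ∀ B' ∈ L, R.Unrelated B'
  unrelated_current : R.Unrelated B
  active_subset : c.active ⊆ {g | c.state ∈ R.flaw g}
  active_unrelated : ∀ g ∈ c.active, ∀ h ∈ B, ¬ R.dep h g
  active_linked : ∀ g ∈ c.active, (L ++ [[g]]).IsChain R.Linked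
  cover : ∀ g, c.state ∈ R.flaw g → g ∈ c.active ∨ ∃ h ∈ B, R.dep g h
  stopped : ¬ c.active.Nonempty → ∀ g, c.state ∉ R.flaw g
  possible : ∃ σ, R.init σ ≠ 0 ∧ ∀ l, R.Possible c.state l → R.Possible σ (c.labels ++ l)

theorem reached_start {σ : Ω} (hσ : R.init σ ≠ 0) : R.Reached (R.start σ) [] [] where
  labels_eq := rfl
  round_eq := rfl
  linked := List.isChain_singleton _
  unrelated := by simp
  unrelated_current := List.Pairwise.nil
  active_subset := active_start_subset σ
  active_unrelated := by simp
  active_linked := fun _ _ => List.isChain_singleton _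
  cover := fun _ hg => Or.inl hg
  stopped := fun h g hg => h ⟨g, hg⟩
  possible := ⟨σ, hσ, fun _ hl => hl⟩

theorem Reached.next {c : Config Ω F} {L : List (List F)} {B : List F} (h : R.Reached c L B)
    {f : F} (hf : f ∈ c.active) {τ : Ω} (hτ : R.oracle f c.state τ ≠ 0) :
    ((R.next c f τ).round = c.round ∧ (R.next c f τ).active ⊂ c.active ∧
      R.Reached (R.next c f τ) L (B ++ [f])) ∨
    ((R.next c f τ).round = c.round + 1 ∧ R.Reached (R.next c f τ) (L ++ [B ++ [f]]) []) := by
  have hposs : ∃ σ, R.init σ ≠ 0 ∧ ∀ l, R.Possible (R.next c f τ).state l →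
      R.Possible σ ((R.next c f τ).labels ++ l) := by
    obtain ⟨σ, hσ, hp⟩ := h.possible
    refine ⟨σ, hσ, fun l hl => ?_⟩
    rw [labels_next, List.append_assoc]
    exact hp _ (Possible.cons (h.active_subset hf) hτ hl)
  -- A flaw unrelated to `f` that holds now held before, by `not_cause`; so it is still active or
  -- was already related to a flaw of this round.
  have hcover : ∀ g, τ ∈ R.flaw g → g ∈ R.remaining c f τ ∨ ∃ h ∈ B ++ [f], R.dep g h := by
    intro g hg
    by_cases hfg : R.dep f g
    · exact Or.inr ⟨f, by simp, R.dep_symm _ _ hfg⟩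
    have hgc : c.state ∈ R.flaw g := by
      by_contra hgc
      exact R.not_cause f g (fun e => hfg (e ▸ R.dep_refl f)) hfg _ _ (h.active_subset hf) hgc hτ hg
    rcases h.cover g hgc with hga | ⟨b, hb, hgb⟩
    · exact Or.inl ⟨hga, hg, hfg⟩
    · exact Or.inr ⟨b, by simp [hb], hgb⟩
  have hU : R.Unrelated (B ++ [f]) :=
    List.pairwise_append.2 ⟨h.unrelated_current, List.pairwise_singleton _ _, fun b hb g hg => by
      rw [List.mem_singleton.1 hg]
      exact h.active_unrelated f hf b hb⟩
  have hlink : (L ++ [B ++ [f]]).IsChain R.Linked := by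
    have h1 := h.linked
    have h2 := h.active_linked f hf
    rw [List.isChain_append] at h1 h2 ⊢
    refine ⟨h1.1, List.isChain_singleton _, fun A hA D hD g hg => ?_⟩
    obtain rfl : B ++ [f] = D := by simpa using hD
    rcases List.mem_append.1 hg with hg | hg
    · exact h1.2.2 A hA B (by simp) g hg
    · exact h2.2.2 A hA [f] (by simp) g hg
  by_cases hr : (R.remaining c f τ).Nonempty
  · left
    have hact : (R.next c f τ).active = R.remaining c f τ := if_pos hr
    have hround : (R.next c f τ).round = c.round := if_pos hr
    refine ⟨hround, ?_, ?_⟩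
    · rw [hact]
      exact ⟨fun g hg => hg.1, fun hs => (hs hf).2.2 (R.dep_refl f)⟩
    · exact
      { labels_eq := by rw [labels_next, h.labels_eq, List.append_assoc]
        round_eq := hround.trans h.round_eq
        linked := hlink
        unrelated := h.unrelated
        unrelated_current := hU
        active_subset := active_next_subset c f τ
        active_unrelated := by
          rw [hact]
          intro g hg b hb
          rcases List.mem_append.1 hb with hb | hb
          · exact h.active_unrelated g hg.1 b hb
          · rw [List.mem_singleton.1 hb]
            exact hg.2.2
        active_linked := by
          rw [hact]
          exact fun g hg => h.active_linked g hg.1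
        cover := by
          rw [hact]
          exact hcover
        stopped := fun hs => (hs (hact ▸ hr)).elim
        possible := hposs }
  · right
    have hact : (R.next c f τ).active = {g | τ ∈ R.flaw g} := if_neg hr
    have hround : (R.next c f τ).round = c.round + 1 := if_neg hr
    refine ⟨hround, ?_⟩
    exact
      { labels_eq := by simp [labels_next, h.labels_eq]
        round_eq := by rw [hround, h.round_eq]; simp
        linked := by
          rw [List.isChain_append]
          refine ⟨hlink, List.isChain_singleton _, fun A hA D hD g hg => ?_⟩
          obtain rfl : [] = D := by simpa using hD
          simp at hg
        unrelated := by
          intro A hA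
          rcases List.mem_append.1 hA with hA | hA
          · exact h.unrelated A hA
          · rw [List.mem_singleton.1 hA]
            exact hU
        unrelated_current := List.Pairwise.nil
        active_subset := active_next_subset c f τ
        active_unrelated := by simp
        active_linked := by
          rw [hact]
          intro g hg
          rw [List.isChain_append]
          refine ⟨hlink, List.isChain_singleton _, fun A hA D hD g' hg' => ?_⟩
          obtain rfl : [g] = D := by simpa using hD
          obtain rfl : B ++ [f] = A := by simpa using hA
          rw [List.mem_singleton.1 hg']
          -- Nothing remains active when a round ends, so each flaw that holds is related to one
          -- resampled in that round.
          exact (hcover g hg).resolve_left fun hm => hr ⟨g, hm⟩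
        cover := by
          rw [hact]
          exact fun g hg => Or.inl hg
        stopped := by
          rw [hact]
          exact fun hs g hg => hs ⟨g, hg⟩
        possible := hposs }

variable (R) in
/-- The sequences of configurations that the framework can produce. -/
structure IsExecution (ω : ℕ → Config Ω F) : Prop where
  init : ∃ σ, R.init σ ≠ 0 ∧ ω 0 = R.start σ
  step : ∀ n, (¬ (ω n).active.Nonempty ∧ ω (n + 1) = ω n) ∨
    ∃ f ∈ (ω n).active, ∃ τ, R.oracle f (ω n).state τ ≠ 0 ∧ ω (n + 1) = R.next (ω n) f τ

theorem runLaw_ae_isExecution (S : Selector Ω F) : ∀ᵐ ω ∂(R.runLaw S), R.IsExecution ω := by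
  filter_upwards [chainLaw_ae_init (R.init.map R.start) (R.step S),
    chainLaw_ae_step (R.init.map R.start) (R.step S)] with ω h0 h1
  constructor
  · rw [← PMF.mem_support_iff, PMF.mem_support_map_iff] at h0
    obtain ⟨σ, hσ, h⟩ := h0
    exact ⟨σ, (PMF.mem_support_iff _ _).1 hσ, h.symm⟩
  · intro n
    have h := h1 n
    rw [← PMF.mem_support_iff, ResamplingOracle.step] at h
    split_ifs at h with hne
    · right
      rw [PMF.mem_support_bind_iff] at h
      obtain ⟨f, hf, h⟩ := h
      rw [PMF.mem_support_map_iff] at h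
      obtain ⟨τ, hτ, h⟩ := h
      exact ⟨f, S.pick_mem _ _ f hf, τ, (PMF.mem_support_iff _ _).1 hτ, h.symm⟩
    · left
      exact ⟨hne, by simpa using h⟩

namespace IsExecution

variable {ω : ℕ → Config Ω F}

theorem reached (h : R.IsExecution ω) (n : ℕ) : ∃ L B, R.Reached (ω n) L B := by
  induction n with
  | zero =>
    obtain ⟨σ, hσ, h0⟩ := h.init
    exact ⟨[], [], h0 ▸ reached_start hσ⟩
  | succ n ih =>
    obtain ⟨L, B, ih⟩ := ih
    rcases h.step n with ⟨-, he⟩ | ⟨f, hf, τ, hτ, he⟩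
    · exact ⟨L, B, he ▸ ih⟩
    · rw [he]
      rcases ih.next hf hτ with ⟨-, -, h'⟩ | ⟨-, h'⟩
      exacts [⟨_, _, h'⟩, ⟨_, _, h'⟩]

theorem step_cases (h : R.IsExecution ω) (n : ℕ) :
    (¬ (ω n).active.Nonempty ∧ ω (n + 1) = ω n) ∨
    ((ω (n + 1)).round = (ω n).round ∧ (ω (n + 1)).active ⊂ (ω n).active) ∨
    ((ω (n + 1)).round = (ω n).round + 1 ∧ ∃ L, R.Reached (ω (n + 1)) L []) := by
  obtain ⟨L, B, hr⟩ := h.reached n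
  rcases h.step n with he | ⟨f, hf, τ, hτ, he⟩
  · exact Or.inl he
  · right
    rw [he]
    rcases hr.next hf hτ with h' | h'
    · exact Or.inl ⟨h'.1, h'.2.1⟩
    · exact Or.inr ⟨h'.1, _, h'.2⟩

theorem round_mono (h : R.IsExecution ω) : Monotone fun n => (ω n).round := by
  refine monotone_nat_of_le_succ fun n => ?_
  rcases h.step_cases n with ⟨-, he⟩ | ⟨he, -⟩ | ⟨he, -⟩
  · rw [he]
  · exact he.ge
  · omega

theorem reached_of_first (h : R.IsExecution ω) {n : ℕ}
    (hn : ∀ m < n, (ω m).round < (ω n).round) : ∃ L, R.Reached (ω n) L [] := by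
  cases n with
  | zero =>
    obtain ⟨σ, hσ, h0⟩ := h.init
    exact ⟨[], h0 ▸ reached_start hσ⟩
  | succ n =>
    have := hn n (by omega)
    rcases h.step_cases n with ⟨-, he⟩ | ⟨he, -⟩ | ⟨-, hL⟩
    · rw [he] at this
      omega
    · omega
    · exact hL

/-- Every flaw at the beginning of round `k` yields a wdag of depth `k` that appears. -/
theorem exists_appears (h : R.IsExecution ω) (hT : R.TCommutative) {k : ℕ} {f : F}
    (hf : f ∈ roundFlaws k ω) :
    ∃ H ∈ R.generated R.ruleOne, H.depth = k ∧ H.sink = {f} ∧ ω ∈ R.appears H := by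
  obtain ⟨n, rfl, hn, hf⟩ := hf
  obtain ⟨L, hr⟩ := h.reached_of_first hn
  have hl : (ω n).labels = L.flatten := by rw [hr.labels_eq, List.append_nil]
  have hfs := hr.active_subset hf
  refine ⟨Wdag.toClass (R.witness ((ω n).labels ++ [f])), ?_, ?_, ?_, n, f, hfs, rfl⟩
  · obtain ⟨σ, hσ, hp⟩ := hr.possible
    -- The execution need not resample `f` next; some trajectory that does so suffices for `H ∈
    -- ℌ_{Q₁}`.
    obtain ⟨τ, hτ⟩ := (R.oracle f (ω n).state).support_nonempty
    exact ⟨σ, _, hσ, by simp, hp _ (Possible.cons hfs ((PMF.mem_support_iff _ _).1 hτ)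
      (Possible.nil τ)), rfl⟩
  · rw [hl, hr.round_eq]
    exact depth_witness_flatten f L (hr.active_linked f hf) hr.unrelated
  · exact hT.sinkLabels_witness _ f

end IsExecution

end ResamplingOracle

/-! ### Counting the wdags that appear -/

namespace WdagClass

variable {F : Type v} {dep : F → F → Prop}

/-- A directed path does not repeat vertices, so there are at least `t` vertices to absorb the
factor `a ^ t`. -/
theorem weight_mul_le {c : F → ℝ≥0∞} {a : ℝ≥0∞} (ha : 1 ≤ a) (H : WdagClass dep) {t : ℕ}
    (ht : t ≤ H.depth) : a ^ t * H.weight c ≤ H.weight fun f => a * c f := by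
  obtain ⟨⟨n, G⟩, rfl⟩ : ∃ G, Wdag.toClass G = H := Quotient.exists_rep H
  have h1 : t ≤ n := ht.trans G.depth_le_card
  change a ^ t * ∏ x, c (G.label x) ≤ ∏ x, a * c (G.label x)
  rw [prod_mul_distrib, prod_const, card_univ, Fintype.card_fin]
  exact mul_le_mul_left (pow_le_pow_right₀ ha h1) _

end WdagClass

namespace ResamplingOracle

variable {Ω : Type u} {F : Type v} {R : ResamplingOracle Ω F}

theorem charge_ne_zero (hμ : ∀ σ, R.init σ ≠ 0) {f : F} {σ : Ω} (hσ : σ ∈ R.flaw f) :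
    R.charge f ≠ 0 := by
  obtain ⟨τ, hτ⟩ := (R.oracle f σ).support_nonempty
  intro h
  have h1 := (ENNReal.iSup_eq_zero.1 h) τ
  rw [ENNReal.tsum_eq_zero] at h1
  have h2 := h1 σ
  rw [A, if_pos hσ, mul_eq_zero, ENNReal.div_eq_zero_iff] at h2
  rcases h2 with (h2 | h2) | h2
  exacts [hμ σ h2, R.init.apply_ne_top τ h2, (PMF.mem_support_iff _ _).1 hτ h2]

theorem Possible.exists_mem {σ : Ω} {l : List F} (h : R.Possible σ l) :
    ∀ f ∈ l, ∃ τ, τ ∈ R.flaw f := by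
  induction h with
  | nil => simp
  | cons hσ _ _ ih =>
    intro g hg
    rcases List.mem_cons.1 hg with rfl | hg
    exacts [⟨_, hσ⟩, ih g hg]

theorem label_witness_mem (l : List F) : ∀ x, (R.witness l).2.label x ∈ l := by
  induction l with
  | nil => exact fun x => Fin.elim0 (show Fin 0 from x)
  | cons f l ih =>
    rcases eq_or_ne l [] with rfl | hl
    · intro x
      obtain rfl : x = (0 : Fin 1) := Subsingleton.elim (α := Fin 1) _ _
      exact List.mem_cons_self ..
    by_cases h : R.Adds f (R.witness l)
    · rw [witness_cons_of_adds hl h]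
      intro x
      induction x using Fin.cases with
      | zero => exact List.mem_cons_self ..
      | succ x => exact List.mem_cons_of_mem _ (ih x)
    · rw [witness_cons_of_not_adds hl h]
      exact fun x => List.mem_cons_of_mem _ (ih x)

theorem weight_ne_zero (hμ : ∀ σ, R.init σ ≠ 0) {c : F → ℝ≥0∞}
    (hc : ∀ f, R.charge f ≠ 0 → c f ≠ 0) {H : WdagClass R.dep} (hH : H ∈ R.generated R.ruleOne) :
    H.weight c ≠ 0 := by
  obtain ⟨σ, l, -, -, hp, rfl⟩ := hH
  change ∏ x, c ((R.witness l).2.label x) ≠ 0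
  refine Finset.prod_ne_zero_iff.2 fun x _ => hc _ ?_
  obtain ⟨τ, hτ⟩ := hp.exists_mem _ (label_witness_mem l x)
  exact charge_ne_zero hμ hτ

variable (R) in
/-- The number of wdags with the property `P` that appear. -/
noncomputable def appearCount (P : WdagClass R.dep → Prop) (ω : ℕ → Config Ω F) : ℝ≥0∞ :=
  ∑' H : {H // P H}, (R.appears H.1).indicator 1 ω

/-- A convergent sum has countably many nonzero terms, and no generated wdag has weight zero because
its labels are flaws that occur. Countability makes the number of appearing wdags measurable. -/
theorem countable_of_tsum_weight_ne_top (hμ : ∀ σ, R.init σ ≠ 0) {P : WdagClass R.dep → Prop}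
    (hP : ∀ H, P H → H ∈ R.generated R.ruleOne)
    (hfin : ∑' H : {H // P H}, H.1.weight R.charge ≠ ∞) : Countable {H // P H} := by
  have h := Summable.countable_support_ennreal hfin
  rw [Set.eq_univ_of_forall (s := Function.support fun H : {H // P H} => H.1.weight R.charge)
    fun H => weight_ne_zero hμ (fun _ h => h) (hP _ H.2)] at h
  exact Set.countable_univ_iff.1 h

theorem measurable_appearCount {P : WdagClass R.dep → Prop} [Countable {H // P H}] :
    Measurable (R.appearCount P) :=
  Measurable.tsum fun H => measurable_one.indicator (measurableSet_appears H.1)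

theorem TCommutative.lintegral_appearCount_le (hT : R.TCommutative) (hμ : ∀ σ, R.init σ ≠ 0)
    (S : Selector Ω F) {P : WdagClass R.dep → Prop} (hP : ∀ H, P H → H ∈ R.generated R.ruleOne) :
    ∫⁻ ω, R.appearCount P ω ∂(R.runLaw S) ≤ ∑' H : {H // P H}, H.1.weight R.charge := by
  by_cases hfin : ∑' H : {H // P H}, H.1.weight R.charge = ∞
  · rw [hfin]; exact le_top
  have := countable_of_tsum_weight_ne_top hμ hP hfin
  simp only [appearCount]
  rw [lintegral_tsum (f := fun (H : {H // P H}) ω => (R.appears H.1).indicator 1 ω)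
    fun H => (measurable_one.indicator (measurableSet_appears H.1)).aemeasurable]
  refine ENNReal.tsum_le_tsum fun H => ?_
  rw [lintegral_indicator_one (measurableSet_appears H.1)]
  exact hT.runLaw_appears_le hμ S H.1

/-- Markov's inequality for the number of wdags that appear. -/
theorem TCommutative.runLaw_le_appearCount_le (hT : R.TCommutative) (hμ : ∀ σ, R.init σ ≠ 0)
    (S : Selector Ω F) {P : WdagClass R.dep → Prop} (hP : ∀ H, P H → H ∈ R.generated R.ruleOne)
    {a : ℝ≥0∞} (ha : a ≠ 0) (ha' : a ≠ ∞) :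
    R.runLaw S {ω | a ≤ R.appearCount P ω} ≤ (∑' H : {H // P H}, H.1.weight R.charge) / a := by
  by_cases hfin : ∑' H : {H // P H}, H.1.weight R.charge = ∞
  · rw [hfin, ENNReal.top_div_of_ne_top ha']
    exact le_top
  have := countable_of_tsum_weight_ne_top hμ hP hfin
  exact (meas_ge_le_lintegral_div measurable_appearCount.aemeasurable ha ha').trans
    (ENNReal.div_le_div_right (hT.lintegral_appearCount_le hμ S hP) a)

/-- The wdag of a pair `(k, f)` with `f ∈ V_k` has depth `k` and sink `{f}`, so it determines the
pair. -/
theorem IsExecution.tsum_encard_le {ω : ℕ → Config Ω F} (h : R.IsExecution ω) (hT : R.TCommutative)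
    (p : ℕ → Prop) :
    ∑' k : {k // p k}, ((roundFlaws k ω).encard : ℝ≥0∞) ≤
      R.appearCount (fun H => H ∈ R.generated R.ruleOne ∧ p H.depth) ω := by
  choose φ hgen hdepth hsink happ using
    fun (q : Σ k : {k // p k}, roundFlaws k.1 ω) => h.exists_appears hT q.2.2
  let ψ : (Σ k : {k // p k}, roundFlaws k.1 ω) →
      {H : WdagClass R.dep // H ∈ R.generated R.ruleOne ∧ p H.depth} :=
    fun q => ⟨φ q, hgen q, by rw [hdepth]; exact q.1.2⟩
  have hψ : ψ.Injective := by
    rintro ⟨⟨k, hk⟩, f, hf⟩ ⟨⟨k', hk'⟩, f', hf'⟩ he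
    have he' : φ ⟨⟨k, hk⟩, f, hf⟩ = φ ⟨⟨k', hk'⟩, f', hf'⟩ := congrArg Subtype.val he
    obtain rfl : k = k' := by
      have h1 := hdepth ⟨⟨k, hk⟩, f, hf⟩
      have h2 := hdepth ⟨⟨k', hk'⟩, f', hf'⟩
      rw [he'] at h1
      exact h1.symm.trans h2
    obtain rfl : f = f' := by
      have h1 := hsink ⟨⟨k, hk⟩, f, hf⟩
      have h2 := hsink ⟨⟨k, hk'⟩, f', hf'⟩
      rw [he'] at h1
      exact Set.singleton_injective (h1.symm.trans h2)
    rfl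
  calc ∑' k : {k // p k}, ((roundFlaws k ω).encard : ℝ≥0∞)
      = ∑' q : (Σ k : {k // p k}, roundFlaws k.1 ω), 1 := by
        rw [ENNReal.tsum_sigma']
        exact tsum_congr fun k => (ENNReal.tsum_set_one _).symm
    _ = ∑' q, (fun H => (R.appears H.1).indicator 1 ω) (ψ q) :=
        tsum_congr fun q => (Set.indicator_of_mem (happ q) 1).symm
    _ ≤ _ := ENNReal.tsum_comp_le_tsum_of_injective hψ _

theorem IsExecution.roundFlaws_nonempty {ω : ℕ → Config Ω F} (h : R.IsExecution ω) {k : ℕ}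
    (hk : ∃ n, (ω n).round = k ∧ (ω n).active.Nonempty) : (roundFlaws k ω).Nonempty := by
  have hex : ∃ n, (ω n).round = k := hk.imp fun _ h => h.1
  obtain ⟨n, hn, hne⟩ := hk
  have hle : Nat.find hex ≤ n := Nat.find_min' hex hn
  have hne' : (ω (Nat.find hex)).active.Nonempty := by
    by_contra hcon
    -- A configuration without active flaws is never left, so `V` would also be empty at the later
    -- time `n`.
    have : ∀ m, Nat.find hex ≤ m → ω m = ω (Nat.find hex) := fun m hm => by
      induction m, hm using Nat.le_induction with
      | base => rfl
      | succ m _ ih =>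
        rcases h.step m with ⟨-, he⟩ | ⟨f, hf, -⟩
        · rw [he, ih]
        · rw [ih] at hf
          exact (hcon ⟨f, hf⟩).elim
    rw [this n hle] at hne
    exact hcon hne
  obtain ⟨f, hf⟩ := hne'
  refine ⟨f, Nat.find hex, Nat.find_spec hex, fun m hm => ?_, hf⟩
  refine lt_of_le_of_ne ?_ (Nat.find_min hex hm)
  rw [← Nat.find_spec hex]
  exact h.round_mono hm.le

/-- If many rounds are executed, then many wdags of large depth appear. -/
theorem IsExecution.numRounds_le {ω : ℕ → Config Ω F} (h : R.IsExecution ω) (hT : R.TCommutative)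
    (t : ℕ) :
    (numRounds ω : ℝ≥0∞) ≤
      R.appearCount (fun H => H ∈ R.generated R.ruleOne ∧ t ≤ H.depth) ω + (t - 1 : ℕ) := by
  set K : Set ℕ := {k | ∃ n, (ω n).round = k ∧ (ω n).active.Nonempty}
  have h1 : ((K ∩ {k | t ≤ k}).encard : ℝ≥0∞) ≤
      R.appearCount (fun H => H ∈ R.generated R.ruleOne ∧ t ≤ H.depth) ω := by
    refine le_trans ?_ (h.tsum_encard_le hT fun k => t ≤ k)
    rw [← ENNReal.tsum_set_one]
    let ψ : ↥(K ∩ {k | t ≤ k}) → {k // t ≤ k} := fun k => ⟨k.1, k.2.2⟩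
    have hψ : ψ.Injective := fun a b hab => Subtype.ext (congrArg (fun k => k.1) hab)
    refine le_trans (ENNReal.tsum_le_tsum fun k => ?_)
      (ENNReal.tsum_comp_le_tsum_of_injective hψ
        fun k : {k // t ≤ k} => ((roundFlaws k ω).encard : ℝ≥0∞))
    have : 1 ≤ (roundFlaws k.1 ω).encard :=
      Set.one_le_encard_iff_nonempty.2 (h.roundFlaws_nonempty k.2.1)
    exact_mod_cast this
  -- Rounds are numbered from `1`, so at most `t - 1` of them precede round `t`; truncated
  -- subtraction makes this correct for `t = 0` too.
  have h2 : K ⊆ (K ∩ {k | t ≤ k}) ∪ (Finset.Ico 1 t : Finset ℕ) := by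
    rintro k ⟨n, hn, hne⟩
    by_cases hk : t ≤ k
    · exact Or.inl ⟨⟨n, hn, hne⟩, hk⟩
    · right
      obtain ⟨L, B, hr⟩ := h.reached n
      have := hr.round_eq
      simp only [Finset.coe_Ico, Set.mem_Ico]
      omega
  have h3 : K.encard ≤ (K ∩ {k | t ≤ k}).encard + (t - 1 : ℕ) := by
    refine (Set.encard_le_encard h2).trans ((Set.encard_union_le _ _).trans ?_)
    rw [Set.encard_coe_eq_coe_finsetCard, Nat.card_Ico]
  calc (numRounds ω : ℝ≥0∞) ≤ (((K ∩ {k | t ≤ k}).encard + (t - 1 : ℕ) : ℕ∞) : ℝ≥0∞) := by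
        exact_mod_cast h3
    _ ≤ _ := by
        push_cast
        gcongr

/-- Each resampling ends the round or strictly shrinks `V`, and each `V_k` is finite. So without
termination every round would end and there would be infinitely many. -/
theorem IsExecution.terminates {ω : ℕ → Config Ω F} (h : R.IsExecution ω)
    (h1 : numRounds ω ≠ ⊤) (h2 : ∑' k : ℕ, ((roundFlaws k ω).encard : ℝ≥0∞) ≠ ∞) :
    R.Terminates ω := by
  by_contra hnt
  have hne : ∀ n, (ω n).active.Nonempty := fun n => by
    by_contra hn
    obtain ⟨L, B, hr⟩ := h.reached n
    exact hnt ⟨n, hr.stopped hn⟩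
  have hstep : ∀ n, ((ω (n + 1)).round = (ω n).round ∧ (ω (n + 1)).active ⊂ (ω n).active) ∨
      (ω (n + 1)).round = (ω n).round + 1 := fun n => by
    rcases h.step_cases n with ⟨he, -⟩ | he | ⟨he, -⟩
    exacts [(he (hne n)).elim, Or.inl he, Or.inr he]
  have hfin : ∀ n, (∀ m < n, (ω m).round < (ω n).round) → (ω n).active.Finite := fun n hn => by
    have hsub : (ω n).active ⊆ roundFlaws (ω n).round ω := fun f hf => ⟨n, rfl, hn, hf⟩
    refine Set.Finite.subset ?_ hsub
    rw [← Set.encard_ne_top_iff]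
    intro htop
    refine ENNReal.ne_top_of_tsum_ne_top h2 (ω n).round ?_
    rw [htop]; rfl
  have hfinite : ∀ n, (ω n).active.Finite := fun n => by
    induction n with
    | zero => exact hfin 0 (by simp)
    | succ n ih =>
      rcases hstep n with ⟨-, hs⟩ | he
      · exact ih.subset hs.1
      · refine hfin _ fun m hm => ?_
        have := h.round_mono (show m ≤ n by omega)
        dsimp only at this
        omega
  have hgrow : ∀ n, ∃ m, n ≤ m ∧ (ω m).round = (ω n).round + 1 := by
    intro n
    by_contra! hcon
    have hc : ∀ j, (ω (n + j)).round = (ω n).round ∧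
        (ω (n + j)).active.ncard + j ≤ (ω n).active.ncard := by
      intro j
      induction j with
      | zero => simp
      | succ j ih =>
        rcases hstep (n + j) with ⟨he, hs⟩ | he
        · refine ⟨he.trans ih.1, ?_⟩
          have := Set.ncard_lt_ncard hs (hfinite _)
          change (ω (n + j + 1)).active.ncard + (j + 1) ≤ _
          omega
        · exact (hcon (n + j + 1) (by omega) (by rw [he, ih.1])).elim
    have := (hc ((ω n).active.ncard + 1)).2
    omega
  have hall : ∀ k, ∃ n, (ω n).round = k + 1 := by
    intro k
    induction k with
    | zero =>
      obtain ⟨σ, -, h0⟩ := h.init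
      exact ⟨0, by rw [h0]; rfl⟩
    | succ k ih =>
      obtain ⟨n, hn⟩ := ih
      obtain ⟨m, -, hm⟩ := hgrow n
      exact ⟨m, by rw [hm, hn]⟩
  refine h1 (Set.encard_eq_top_iff.2 (Set.infinite_of_injective_forall_mem
    (f := fun k : ℕ => k + 1) (fun a b hab => Nat.succ_injective hab) fun k => ?_))
  obtain ⟨n, hn⟩ := hall k
  exact ⟨n, hn, hne n⟩

/-- The integral is a supremum over measurable minorants and hence superadditive for arbitrary
functions, so measurability of `|V_k|` is not required. -/
theorem tsum_lintegral_le {α : Type*} [MeasurableSpace α] (μ : Measure α) (f : ℕ → α → ℝ≥0∞) :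
    ∑' k, ∫⁻ a, f k a ∂μ ≤ ∫⁻ a, ∑' k, f k a ∂μ := by
  refine ENNReal.tsum_le_of_sum_range_le fun n => ?_
  have : ∑ k ∈ range n, ∫⁻ a, f k a ∂μ ≤ ∫⁻ a, ∑ k ∈ range n, f k a ∂μ := by
    induction n with
    | zero => simp
    | succ n ih =>
      simp only [sum_range_succ]
      exact (add_le_add_left ih _).trans (le_lintegral_add _ _)
  exact this.trans (lintegral_mono fun a => ENNReal.sum_le_tsum _)

/-- Each generated wdag has exactly one sink label, namely the last flaw of its sequence. -/
theorem TCommutative.tsum_weight_le_tsum_Phi (hT : R.TCommutative) :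
    ∑' H : {H : WdagClass R.dep // H ∈ R.generated R.ruleOne ∧ 0 ≤ H.depth}, H.1.weight R.charge ≤
      ∑' f, R.Phi R.ruleOne f := by
  have hs : ∀ H : {H : WdagClass R.dep // H ∈ R.generated R.ruleOne ∧ 0 ≤ H.depth}, ∃ f, H.1.sink = {f} := by
    rintro ⟨H, ⟨σ, l, -, hl, -, rfl⟩, -⟩
    obtain ⟨l, f, rfl⟩ := (List.eq_nil_or_concat' l).resolve_left hl
    exact ⟨f, hT.sinkLabels_witness l f⟩
  choose φ hφ using hs
  let ψ : {H : WdagClass R.dep // H ∈ R.generated R.ruleOne ∧ 0 ≤ H.depth} →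
      Σ f, {H : WdagClass R.dep // H ∈ R.generated R.ruleOne ∧ H.sink = {f}} :=
    fun H => ⟨φ H, H.1, H.2.1, hφ H⟩
  have hψ : ψ.Injective := fun H H' h => Subtype.ext (congrArg (fun q => q.2.1) h)
  refine (ENNReal.tsum_comp_le_tsum_of_injective hψ fun q => q.2.1.weight R.charge).trans ?_
  rw [ENNReal.tsum_sigma']
  rfl

end ResamplingOracle

/-! ### Tail bounds for rounds and flaws -/

namespace ResamplingOracle

variable {Ω : Type u} {F : Type v} {R : ResamplingOracle Ω F}

theorem IsExecution.tsum_encard_le_appearCount {ω : ℕ → Config Ω F} (h : R.IsExecution ω)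
    (hT : R.TCommutative) :
    ∑' k : ℕ, ((roundFlaws k ω).encard : ℝ≥0∞) ≤
      R.appearCount (fun H => H ∈ R.generated R.ruleOne ∧ 0 ≤ H.depth) ω := by
  rw [← (Equiv.subtypeUnivEquiv (p := fun k : ℕ => 0 ≤ k) fun _ => Nat.zero_le _).tsum_eq]
  exact h.tsum_encard_le hT _

theorem TCommutative.tsum_lintegral_encard_le (hT : R.TCommutative) (hμ : ∀ σ, R.init σ ≠ 0)
    (S : Selector Ω F) :
    ∑' k : ℕ, ∫⁻ ω, ((roundFlaws k ω).encard : ℝ≥0∞) ∂(R.runLaw S) ≤ ∑' f, R.Phi R.ruleOne f := by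
  refine (tsum_lintegral_le _ _).trans (le_trans (lintegral_mono_ae ?_)
    ((hT.lintegral_appearCount_le hμ S fun _ hH => hH.1).trans hT.tsum_weight_le_tsum_Phi))
  filter_upwards [runLaw_ae_isExecution S] with ω hω
  exact hω.tsum_encard_le_appearCount hT

/-- At most `t - 1` rounds precede round `t`, so more than `2t` rounds force at least `t` wdags of
depth at least `t` to appear; Markov's inequality applies. -/
theorem TCommutative.runLaw_numRounds_le (hT : R.TCommutative) (hμ : ∀ σ, R.init σ ≠ 0)
    (S : Selector Ω F) {t : ℕ} (ht : 1 ≤ t) :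
    R.runLaw S {ω | ((2 * t : ℕ) : ℕ∞) < numRounds ω} ≤
      (∑' H : {H : WdagClass R.dep // H ∈ R.generated R.ruleOne ∧ t ≤ H.depth},
        H.1.weight R.charge) / t := by
  refine le_trans (measure_mono_ae ?_) (hT.runLaw_le_appearCount_le hμ S
    (P := fun H => H ∈ R.generated R.ruleOne ∧ t ≤ H.depth) (fun _ hH => hH.1)
    (a := t) (by simpa using (by omega : t ≠ 0)) (ENNReal.natCast_ne_top t))
  filter_upwards [runLaw_ae_isExecution S] with ω hω h
  change ((2 * t : ℕ) : ℕ∞) < numRounds ω at h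
  change (t : ℝ≥0∞) ≤ _
  by_contra! hlt
  have h1 : ((2 * t : ℕ) : ℝ≥0∞) < (numRounds ω : ℝ≥0∞) := by exact_mod_cast h
  have h2 := hω.numRounds_le hT t
  have h3 : R.appearCount (fun H => H ∈ R.generated R.ruleOne ∧ t ≤ H.depth) ω + (t - 1 : ℕ) ≤
      (2 * t : ℕ) := by
    calc _ ≤ (t : ℝ≥0∞) + (t - 1 : ℕ) := by gcongr
      _ = ((t + (t - 1) : ℕ) : ℝ≥0∞) := by push_cast; rfl
      _ ≤ _ := by
        rw [Nat.cast_le]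
        omega
  exact absurd (h1.trans_le (h2.trans h3)) (lt_irrefl _)

theorem TCommutative.runLaw_numRounds_pos_le (hT : R.TCommutative) (hμ : ∀ σ, R.init σ ≠ 0)
    (S : Selector Ω F) :
    R.runLaw S {ω | numRounds ω ≠ 0} ≤
      ∑' H : {H : WdagClass R.dep // H ∈ R.generated R.ruleOne ∧ 0 ≤ H.depth},
        H.1.weight R.charge := by
  refine le_trans (measure_mono_ae ?_) ((hT.runLaw_le_appearCount_le hμ S
    (P := fun H => H ∈ R.generated R.ruleOne ∧ 0 ≤ H.depth) (fun _ hH => hH.1)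
    one_ne_zero ENNReal.one_ne_top).trans (by rw [div_one]))
  filter_upwards [runLaw_ae_isExecution S] with ω hω h
  have h2 := hω.numRounds_le hT 0
  have h1 : (1 : ℕ∞) ≤ numRounds ω := Order.one_le_iff_pos.2 (pos_iff_ne_zero.2 h)
  have h1' : (1 : ℝ≥0∞) ≤ (numRounds ω : ℝ≥0∞) := by exact_mod_cast h1
  change (1 : ℝ≥0∞) ≤ _
  simpa using h1'.trans h2

theorem pow_mul_tsum_weight_le {ε : ℝ} (hε : 0 ≤ ε) (t : ℕ) :
    ENNReal.ofReal (1 + ε) ^ t *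
      ∑' H : {H : WdagClass R.dep // H ∈ R.generated R.ruleOne ∧ t ≤ H.depth},
        H.1.weight R.charge ≤ R.inflatedSum ε := by
  rw [← ENNReal.tsum_mul_left]
  let ψ : {H : WdagClass R.dep // H ∈ R.generated R.ruleOne ∧ t ≤ H.depth} →
    {H : WdagClass R.dep // H ∈ R.generated R.ruleOne} := fun H => ⟨H.1, H.2.1⟩
  have hψ : ψ.Injective := fun H H' h => Subtype.ext (congrArg (fun q => q.1) h)
  refine le_trans (ENNReal.tsum_le_tsum fun H => ?_) (ENNReal.tsum_comp_le_tsum_of_injective hψ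
    fun H => H.1.weight fun f => ENNReal.ofReal (1 + ε) * R.charge f)
  exact WdagClass.weight_mul_le (by rw [ENNReal.one_le_ofReal]; linarith) H.1 H.2.2

theorem TCommutative.runLaw_tsum_encard_gt_le (hT : R.TCommutative) (hμ : ∀ σ, R.init σ ≠ 0)
    (S : Selector Ω F) {ε δ C : ℝ} (hε : 0 < ε) (hδ : 0 < δ) (hC : 2 ≤ C)
    (hW : R.inflatedSum ε ≠ ∞) :
    R.runLaw S {ω | ENNReal.ofReal (C * (R.inflatedSum ε).toReal / δ) <
      ∑' k : ℕ, ((roundFlaws k ω).encard : ℝ≥0∞)} ≤ ENNReal.ofReal (δ / 2) := by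
  have hsum : ∑' H : {H : WdagClass R.dep // H ∈ R.generated R.ruleOne ∧ 0 ≤ H.depth},
      H.1.weight R.charge ≤ R.inflatedSum ε := by
    simpa using pow_mul_tsum_weight_le (R := R) hε.le 0
  -- Markov's inequality is useless at level `0`. But if `W_ε = 0`, then no wdag is generated, since
  -- generated ones have nonzero weight.
  rcases eq_or_ne (R.inflatedSum ε) 0 with h0 | h0
  · rw [h0, nonpos_iff_eq_zero, ENNReal.tsum_eq_zero] at hsum
    refine le_trans (le_of_eq ?_) zero_le
    rw [measure_eq_zero_iff_ae_notMem]
    filter_upwards [runLaw_ae_isExecution S] with ω hω h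
    have h1 := (hω.tsum_encard_le_appearCount hT).trans_lt' h
    have h2 : R.appearCount (fun H => H ∈ R.generated R.ruleOne ∧ 0 ≤ H.depth) ω = 0 :=
      ENNReal.tsum_eq_zero.2 fun H =>
        (weight_ne_zero hμ (fun _ h => h) H.2.1 (hsum H)).elim
    rw [h2] at h1
    exact not_lt_zero h1
  · have hpos : 0 < (R.inflatedSum ε).toReal := ENNReal.toReal_pos h0 hW
    refine le_trans (measure_mono_ae ?_) ((hT.runLaw_le_appearCount_le hμ S
      (P := fun H => H ∈ R.generated R.ruleOne ∧ 0 ≤ H.depth) (fun _ hH => hH.1)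
      (a := ENNReal.ofReal (C * (R.inflatedSum ε).toReal / δ)) ?_ ENNReal.ofReal_ne_top).trans ?_)
    · filter_upwards [runLaw_ae_isExecution S] with ω hω h
      exact le_trans (le_of_lt h) (hω.tsum_encard_le_appearCount hT)
    · rw [ne_eq, ENNReal.ofReal_eq_zero, not_le]
      positivity
    · refine ENNReal.div_le_of_le_mul (hsum.trans ?_)
      rw [← ENNReal.ofReal_mul (by positivity), ← ENNReal.ofReal_toReal hW]
      refine ENNReal.ofReal_le_ofReal ?_
      rw [ENNReal.toReal_ofReal hpos.le]
      have : δ / 2 * (C * (R.inflatedSum ε).toReal / δ) = C / 2 * (R.inflatedSum ε).toReal := by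
        field_simp
      rw [this]
      nlinarith

end ResamplingOracle

/-- Part 2 gives failure probability at most `W / (t (1 + ε)^t)`, to be made at most `δ / 2` with
`2t` rounds within the allowance. If the allowance is below two rounds, `W ≤ δ / 2` instead bounds
the probability of any round. -/
theorem exists_round_bound {ε₀ C ε δ W : ℝ} (hC : C = 72 + 2 * ε₀ + 12 * (1 + ε₀)) (hε : 0 < ε)
    (hε₀ : ε ≤ ε₀) (hδ : 0 < δ) (hδ1 : δ < 1) (hW : 0 ≤ W) :
    W ≤ δ / 2 ∨ ∃ t : ℕ, 1 ≤ t ∧ (2 * t : ℝ) ≤ C * Real.log (1 / δ + ε * W) / ε ∧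
      W ≤ δ / 2 * t * (1 + ε) ^ t := by
  have hδi : 1 < 1 / δ := by rw [lt_div_iff₀ hδ]; linarith
  have hx : 0 ≤ ε * W := by positivity
  set L := Real.log (1 / δ + ε * W) with hL
  have hexp : Real.exp L = 1 / δ + ε * W := Real.exp_log (by linarith)
  have hLpos : 0 < L := Real.log_pos (by linarith)
  have hCpos : 72 < C := by linarith
  -- From `e^L ≤ 1 + 2L ≤ 3`, where `e^L = 1/δ + εW` and `1/δ > 1`.
  have hsmall : L ≤ 1 → 1 / 3 ≤ δ ∧ ε * W ≤ 2 * L := fun hL1 => by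
    have h1 := Real.abs_exp_sub_one_le (x := L) (by rwa [abs_of_pos hLpos])
    rw [abs_of_pos hLpos] at h1
    have h2 := (le_abs_self _).trans h1
    rw [hexp] at h2
    refine ⟨?_, by linarith⟩
    have h3 : 1 / δ ≤ 3 := by linarith
    rw [div_le_iff₀ hδ] at h3
    linarith
  rcases lt_or_ge (C * L / ε) 2 with hX | hX
  · left
    rw [div_lt_iff₀ hε] at hX
    -- The summand `2ε₀` of `C` is for this: `C L < 2ε ≤ 2ε₀ < C`.
    have hL1 : L ≤ 1 := by nlinarith
    obtain ⟨h1, h2⟩ := hsmall hL1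
    -- Here `72 L ≤ C L < 2ε` and `εW ≤ 2L`; thus `W ≤ 1/18`, below `δ/2 ≥ 1/6`.
    have h3 : ε * (36 * W) ≤ ε * 2 := by nlinarith
    have h4 := le_of_mul_le_mul_left h3 hε
    linarith
  · right
    refine ⟨⌊C * L / ε / 2⌋₊, ?_, ?_, ?_⟩
    · exact Nat.le_floor (by push_cast; linarith)
    · have := Nat.floor_le (a := C * L / ε / 2) (by linarith)
      linarith
    · have ht1 : (1 : ℝ) ≤ (⌊C * L / ε / 2⌋₊ : ℝ) := by
        exact_mod_cast Nat.le_floor (by push_cast; linarith)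
      have ht2 := Nat.lt_floor_add_one (C * L / ε / 2)
      set t := ⌊C * L / ε / 2⌋₊
      -- Rounding down costs at most a factor of two, as `t + 1 ≤ 2t`.
      have ht3 : C * L / ε ≤ 4 * t := by linarith
      rw [div_le_iff₀ hε] at ht3
      rcases le_or_gt L 1 with hL1 | hL1
      · obtain ⟨h1, h2⟩ := hsmall hL1
        have h3 : ε * W ≤ ε * (t / 6) := by nlinarith
        have h4 := le_of_mul_le_mul_left h3 hε
        have h5 : (1 : ℝ) ≤ (1 + ε) ^ t := one_le_pow₀ (by linarith)
        have h6 : (t : ℝ) / 6 ≤ δ / 2 * t := by nlinarith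
        calc W ≤ δ / 2 * t := h4.trans h6
          _ ≤ _ := le_mul_of_one_le_right (by positivity) h5
      · have h1 : 1 - (1 + ε)⁻¹ ≤ Real.log (1 + ε) := Real.one_sub_inv_le_log_of_pos (by linarith)
        have h2 : ε / (1 + ε₀) ≤ Real.log (1 + ε) := by
          refine le_trans ?_ h1
          rw [div_le_iff₀ (by linarith)]
          have : 1 - (1 + ε)⁻¹ = ε / (1 + ε) := by field_simp; ring
          rw [this, div_mul_eq_mul_div, le_div_iff₀ (by linarith)]
          nlinarith
        -- The summand `12(1 + ε₀)` compensates the loss in `log (1 + ε) ≥ ε / (1 + ε₀)`. Then `(1 +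
        -- ε)^t ≥ e^{2L}`, whose cross term supplies `2εW/δ`.
        have h3 : 2 * L ≤ t * Real.log (1 + ε) := by
          have h4 : 2 * L ≤ t * (ε / (1 + ε₀)) := by
            rw [← mul_div_assoc, le_div_iff₀ (by linarith)]
            nlinarith
          exact h4.trans (by gcongr)
        have h4 : (1 / δ + ε * W) ^ 2 ≤ (1 + ε) ^ t := by
          rw [← hexp, ← Real.exp_nat_mul, ← Real.exp_log (show 0 < 1 + ε by linarith),
            ← Real.exp_nat_mul]
          exact Real.exp_le_exp.2 (by exact_mod_cast h3)
        have h5 : 2 * (ε * W) / δ ≤ (1 / δ + ε * W) ^ 2 := by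
          have : 2 * (ε * W) / δ = 2 * (1 / δ) * (ε * W) := by field_simp
          rw [this]
          nlinarith [sq_nonneg (1 / δ), sq_nonneg (ε * W)]
        have h6 : 1 ≤ t * ε := by nlinarith
        calc W ≤ t * ε * W := le_mul_of_one_le_left hW h6
          _ = δ / 2 * t * (2 * (ε * W) / δ) := by field_simp
          _ ≤ _ := mul_le_mul_of_nonneg_left (h5.trans h4) (by positivity)

namespace ResamplingOracle

variable {Ω : Type u} {F : Type v} {R : ResamplingOracle Ω F}

theorem TCommutative.runLaw_numRounds_gt_le (hT : R.TCommutative) (hμ : ∀ σ, R.init σ ≠ 0)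
    (S : Selector Ω F) {ε₀ ε δ C : ℝ} (hC : C = 72 + 2 * ε₀ + 12 * (1 + ε₀)) (hε : 0 < ε)
    (hε₀ : ε ≤ ε₀) (hδ : 0 < δ) (hδ1 : δ < 1) (hW : R.inflatedSum ε ≠ ∞) :
    R.runLaw S {ω | ENNReal.ofReal (C * Real.log (1 / δ + ε * (R.inflatedSum ε).toReal) / ε) <
      (numRounds ω : ℝ≥0∞)} ≤ ENNReal.ofReal (δ / 2) := by
  rcases exists_round_bound hC hε hε₀ hδ hδ1 (W := (R.inflatedSum ε).toReal) ENNReal.toReal_nonneg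
    with h | ⟨t, ht, h1, h2⟩
  · refine (measure_mono fun ω hω => ?_).trans ((hT.runLaw_numRounds_pos_le hμ S).trans ?_)
    · intro h0
      change _ < (numRounds ω : ℝ≥0∞) at hω
      rw [h0] at hω
      simp at hω
    · have := pow_mul_tsum_weight_le (R := R) hε.le 0
      rw [pow_zero, one_mul] at this
      refine this.trans ?_
      rw [← ENNReal.ofReal_toReal hW]
      exact ENNReal.ofReal_le_ofReal h
  · refine (measure_mono fun ω hω => ?_).trans ((hT.runLaw_numRounds_le hμ S ht).trans ?_)
    · change _ < (numRounds ω : ℝ≥0∞) at hω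
      change ((2 * t : ℕ) : ℕ∞) < numRounds ω
      have h3 : ((2 * t : ℕ) : ℝ≥0∞) < (numRounds ω : ℝ≥0∞) := by
        refine lt_of_le_of_lt ?_ hω
        rw [← ENNReal.ofReal_natCast]
        exact ENNReal.ofReal_le_ofReal (by push_cast; exact h1)
      exact_mod_cast h3
    · have h3 := pow_mul_tsum_weight_le (R := R) hε.le t
      refine ENNReal.div_le_of_le_mul ?_
      have ha : ENNReal.ofReal (1 + ε) ^ t ≠ 0 :=
        pow_ne_zero _ (by rw [ne_eq, ENNReal.ofReal_eq_zero]; linarith)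
      have ha' : ENNReal.ofReal (1 + ε) ^ t ≠ ∞ := ENNReal.pow_ne_top ENNReal.ofReal_ne_top
      rw [← ENNReal.mul_le_mul_iff_right ha ha']
      refine h3.trans ?_
      rw [← ENNReal.ofReal_toReal hW, ← ENNReal.ofReal_pow (by linarith), ← ENNReal.ofReal_natCast,
        ← ENNReal.ofReal_mul (by positivity), ← ENNReal.ofReal_mul (by positivity)]
      refine ENNReal.ofReal_le_ofReal ?_
      rw [mul_comm]
      exact h2

end ResamplingOracle

end LocalSearch

theorem corollary6p4 :
    (∀ (Ω : Type u) (F : Type v) (R : ResamplingOracle Ω F) (S : Selector Ω F),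
      R.TCommutative → (∀ σ, R.init σ ≠ 0) →
        (∑' k : ℕ, ∫⁻ ω, ((roundFlaws k ω).encard : ℝ≥0∞) ∂(R.runLaw S) ≤
            ∑' f, R.Phi R.ruleOne f) ∧
        (∀ t : ℕ, 1 ≤ t →
          R.runLaw S {ω | ((2 * t : ℕ) : ℕ∞) < numRounds ω} ≤
            (∑' H : {H : WdagClass R.dep // H ∈ R.generated R.ruleOne ∧ t ≤ H.depth},
              H.1.weight R.charge) / t)) ∧
    (∀ ε₀ : ℝ, 0 < ε₀ → ∃ C : ℝ, 0 < C ∧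
      ∀ (Ω : Type u) (F : Type v) (R : ResamplingOracle Ω F) (S : Selector Ω F),
        R.TCommutative → (∀ σ, R.init σ ≠ 0) →
          ∀ ε δ : ℝ, 0 < ε → ε ≤ ε₀ → 0 < δ → δ < 1 → R.inflatedSum ε ≠ ∞ →
            ENNReal.ofReal (1 - δ) ≤
              R.runLaw S {ω | R.Terminates ω ∧
                (numRounds ω : ℝ≥0∞) ≤
                  ENNReal.ofReal (C * Real.log (1 / δ + ε * (R.inflatedSum ε).toReal) / ε) ∧
                ∑' k : ℕ, ((roundFlaws k ω).encard : ℝ≥0∞) ≤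
                  ENNReal.ofReal (C * (R.inflatedSum ε).toReal / δ)}) := by
  refine ⟨fun Ω F R S hT hμ => ⟨hT.tsum_lintegral_encard_le hμ S,
    fun t ht => hT.runLaw_numRounds_le hμ S ht⟩, fun ε₀ hε₀ =>
    ⟨72 + 2 * ε₀ + 12 * (1 + ε₀), by positivity, ?_⟩⟩
  intro Ω F R S hT hμ ε δ hε hεε₀ hδ hδ1 hW
  set C := 72 + 2 * ε₀ + 12 * (1 + ε₀) with hC
  set G : Set (ℕ → Config Ω F) := {ω | R.Terminates ω ∧
    (numRounds ω : ℝ≥0∞) ≤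
      ENNReal.ofReal (C * Real.log (1 / δ + ε * (R.inflatedSum ε).toReal) / ε) ∧
    ∑' k : ℕ, ((roundFlaws k ω).encard : ℝ≥0∞) ≤
      ENNReal.ofReal (C * (R.inflatedSum ε).toReal / δ)}
  have h1 := hT.runLaw_numRounds_gt_le hμ S hC hε hεε₀ hδ hδ1 hW
  have h2 := hT.runLaw_tsum_encard_gt_le hμ S hε hδ (C := C) (by linarith) hW
  have h3 : R.runLaw S Gᶜ ≤ ENNReal.ofReal δ := by
    calc R.runLaw S Gᶜ ≤ R.runLaw S
          ({ω | ENNReal.ofReal (C * Real.log (1 / δ + ε * (R.inflatedSum ε).toReal) / ε) <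
            (numRounds ω : ℝ≥0∞)} ∪
          {ω | ENNReal.ofReal (C * (R.inflatedSum ε).toReal / δ) <
            ∑' k : ℕ, ((roundFlaws k ω).encard : ℝ≥0∞)}) := by
          refine measure_mono_ae ?_
          filter_upwards [ResamplingOracle.runLaw_ae_isExecution S] with ω hω hG
          by_contra hcon
          have hr := not_lt.1 fun h : ENNReal.ofReal (C * Real.log (1 / δ + ε *
            (R.inflatedSum ε).toReal) / ε) < (numRounds ω : ℝ≥0∞) => hcon (Or.inl h)
          have hs := not_lt.1 fun h : ENNReal.ofReal (C * (R.inflatedSum ε).toReal / δ) <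
            ∑' k : ℕ, ((roundFlaws k ω).encard : ℝ≥0∞) => hcon (Or.inr h)
          -- Termination costs no probability: it follows from the two bounds being finite.
          refine hG ⟨hω.terminates (fun htop => ?_) (hs.trans_lt ENNReal.ofReal_lt_top).ne, hr, hs⟩
          rw [htop] at hr
          exact ENNReal.ofReal_ne_top (top_le_iff.1 hr)
      _ ≤ _ := (measure_union_le _ _).trans (add_le_add h1 h2)
      _ = ENNReal.ofReal δ := by
          rw [← ENNReal.ofReal_add (by positivity) (by positivity), add_halves]
  rw [ENNReal.ofReal_sub _ hδ.le, ENNReal.ofReal_one, tsub_le_iff_right]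
  -- Subadditivity of the outer measure avoids the measurability of `G`.
  calc (1 : ℝ≥0∞) = R.runLaw S (G ∪ Gᶜ) := by rw [Set.union_compl_self, measure_univ]
    _ ≤ R.runLaw S G + R.runLaw S Gᶜ := measure_union_le _ _
    _ ≤ _ := by gcongr
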